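/- Let $\mathbb H$ be the quaternions, $\mathbb S^3\subset\mathbb H$ the unit sphere, and write tangent vectors of $\mathbb S^3\times\mathbb S^3$ at $(p,q)$ as $Z=(U,V)$ with $U\in T_p\mathbb S^3$, $V\in T_q\mathbb S^3$. Put $$JZ=\tfrac1{\sqrt3}\,(2pq^{-1}V-U,\,-2qp^{-1}U+V),\qquad PZ=(pq^{-1}V,\,qp^{-1}U),\qquad g(Z,Z')=\tfrac12\big(\langle Z,Z'\rangle+\langle JZ,JZ'\rangle\big),$$ where $\langle\cdot,\cdot\rangle$ is the standard product metric; this is the homogeneous nearly Kähler $\mathbb S^3\times\mathbb S^3$. Let $\tilde\nabla$ be the Levi-Civita connection of $g$ and $G=\tilde\nabla J$, i.e. $G(X,Y)=(\tilde\nabla_XJ)Y$. Let $M$ be a Lagrangian submanifold, i.e. an immersed smooth $3$-manifold such that $J$ maps the tangent spaces of $M$ onto its normal spaces. Let $\nabla$ and $\nabla^\perp$ be the induced connection and the normal connection, $h$ the second fundamental form, and $$(\nabla h)(X,Y,Z)=\nabla^\perp_Xh(Y,Z)-h(\nabla_XY,Z)-h(Y,\nabla_XZ).$$ For a function $\lambda:M\to\mathbb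 R$, say that $M$ is $J$-isotropic with function $\lambda$ if $$g((\nabla h)(v,v,v),Jv)=\lambda(x)\,(g(v,v))^2\qquad\text{for all }x\in M,\ v\in T_xM,$$ and $J$-isotropic if this holds for some function $\lambda$. **Proposition.** For every function $\lambda$ on $M$, $M$ is $J$-isotropic with function $\lambda$ if and only if $$\begin{aligned} &12\,g((\nabla h)(Y,Z,W),JV)+3\mathop{\mathfrak S}_{YZW}g(h(Y,Z),G(W,V))\\ &\quad+2\mathop{\mathfrak S}_{ZWV}\big[g(PY,Z)\,g(PJW,V)-g(PJY,Z)\,g(PW,V)\big] -4\lambda\mathop{\mathfrak S}_{ZWV}g(Y,Z)\,g(W,V)=0 \end{aligned}$$ for all smooth vector fields $Y,Z,W,V$ tangent to $M$, where $\mathfrak S$ denotes the cyclic sum over the three indicated arguments. In particular, $M$ is $J$-isotropic if and only if there is a function $\lambda$ on $M$ for which this identity holds for all $Y,Z,W,V$. -/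

import Mathlib

open scoped Quaternion Manifold ContDiff

noncomputable section

namespace NKS3S3

/-! ### The ambient space: pairs of quaternions, and `S³ × S³` inside it -/

/-- Pairs of quaternions. -/
abbrev HH : Type := ℍ × ℍ

instance fact_finrank_quaternion : Fact (Module.finrank ℝ ℍ = 3 + 1) :=
  ⟨Quaternion.finrank_eq_four⟩

/-- The unit sphere `S³` of the quaternions, with Mathlib's smooth structure. -/
abbrev S3 : Type := Metric.sphere (0 : ℍ) 1

/-- The subset `S³ × S³` of `ℍ × ℍ`. -/
def S3xS3 : Set HH := {x | ‖x.1‖ = 1 ∧ ‖x.2‖ = 1}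

/-- `Z = (U, V)` is tangent to `S³ × S³` at `x = (p, q)`, under the identification
`T_{(p,q)}(S³ × S³) = T_p S³ ⊕ T_q S³ = p^⊥ ⊕ q^⊥`. -/
def IsTangent (x Z : HH) : Prop := inner ℝ x.1 Z.1 = 0 ∧ inner ℝ x.2 Z.2 = 0

/-- The almost complex structure
`J (U, V) = (1/√3) (2 p q⁻¹ V - U, -2 q p⁻¹ U + V)` at `x = (p, q)`. -/
def nkJ (x Z : HH) : HH :=
  ((1 / Real.sqrt 3) • ((2 : ℝ) • (x.1 * x.2⁻¹ * Z.2) - Z.1),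
    (1 / Real.sqrt 3) • (-((2 : ℝ) • (x.2 * x.1⁻¹ * Z.1)) + Z.2))

/-- The almost product structure `P (U, V) = (p q⁻¹ V, q p⁻¹ U)` at `x = (p, q)`. -/
def nkP (x Z : HH) : HH := (x.1 * x.2⁻¹ * Z.2, x.2 * x.1⁻¹ * Z.1)

/-- The standard product metric. -/
def stdMetric (Z Z' : HH) : ℝ := inner ℝ Z.1 Z'.1 + inner ℝ Z.2 Z'.2

/-- The nearly Kähler metric `g(Z, Z') = (⟨Z, Z'⟩ + ⟨J Z, J Z'⟩) / 2` at `x`. -/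
def nkMetric (x Z Z' : HH) : ℝ :=
  1 / 2 * (stdMetric Z Z' + stdMetric (nkJ x Z) (nkJ x Z'))

/-! ### Vector fields on `S³ × S³` and the Levi-Civita connection of `g` -/

/-- A smooth vector field on `S³ × S³`, given by a map on `ℍ × ℍ` which is smooth at the points of
`S³ × S³` (only its values on `S³ × S³` matter) and tangent to `S³ × S³` there. -/
structure IsVectorField (X : HH → HH) : Prop where
  smooth : ∀ x ∈ S3xS3, ContDiffAt ℝ ∞ X x
  tangent : ∀ x ∈ S3xS3, IsTangent x (X x)

/-- `D X Y = ∇̃_X Y` is the Levi-Civita connection of `g`: an affine connection on `S³ × S³` which is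
torsion-free and compatible with `g`. For fields `X`, `Y` tangent to `S³ × S³` the derivative
`X φ` is `fderiv ℝ φ x (X x)` and the Lie bracket `[X, Y]` is
`fderiv ℝ Y x (X x) - fderiv ℝ X x (Y x)`. -/
structure IsLeviCivita (D : (HH → HH) → (HH → HH) → HH → HH) : Prop where
  tangent : ∀ X Y, IsVectorField X → IsVectorField Y → ∀ x ∈ S3xS3, IsTangent x (D X Y x)
  add_left : ∀ X X' Y, IsVectorField X → IsVectorField X' → IsVectorField Y → ∀ x ∈ S3xS3,
    D (fun y => X y + X' y) Y x = D X Y x + D X' Y x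
  smul_left : ∀ (φ : HH → ℝ) (X Y : HH → HH), (∀ x ∈ S3xS3, ContDiffAt ℝ ∞ φ x) →
    IsVectorField X → IsVectorField Y → ∀ x ∈ S3xS3,
    D (fun y => φ y • X y) Y x = φ x • D X Y x
  add_right : ∀ X Y Y', IsVectorField X → IsVectorField Y → IsVectorField Y' → ∀ x ∈ S3xS3,
    D X (fun y => Y y + Y' y) x = D X Y x + D X Y' x
  leibniz : ∀ (φ : HH → ℝ) (X Y : HH → HH), (∀ x ∈ S3xS3, ContDiffAt ℝ ∞ φ x) →
    IsVectorField X → IsVectorField Y → ∀ x ∈ S3xS3,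
    D X (fun y => φ y • Y y) x = fderiv ℝ φ x (X x) • Y x + φ x • D X Y x
  torsion_free : ∀ X Y, IsVectorField X → IsVectorField Y → ∀ x ∈ S3xS3,
    D X Y x - D Y X x = fderiv ℝ Y x (X x) - fderiv ℝ X x (Y x)
  metric : ∀ X Y Z, IsVectorField X → IsVectorField Y → IsVectorField Z → ∀ x ∈ S3xS3,
    fderiv ℝ (fun y => nkMetric y (Y y) (Z y)) x (X x) =
      nkMetric x (D X Y x) (Z x) + nkMetric x (Y x) (D X Z x)

/-! ### Left translation and existence and uniqueness of the Levi-Civita connection -/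

/-- `(p, q), (a, b) ↦ (p a, q b)`. -/
def leftMul (x a : HH) : HH := (x.1 * a.1, x.2 * a.2)

/-- The left trivialization `(p, q), (U, V) ↦ (p⁻¹ U, q⁻¹ V)`, inverse to `leftMul`. -/
def leftTriv (x U : HH) : HH := (x.1⁻¹ * U.1, x.2⁻¹ * U.2)

/-- The left-invariant vector field `(p, q) ↦ (p a, q b)`. -/
def leftInv (a : HH) : HH → HH := fun x => leftMul x a

/-- Cross product of (imaginary) quaternions. -/
def cross (a b : ℍ) : ℍ := (1 / 2 : ℝ) • (a * b - b * a)

/-- The connection coefficients of the Levi-Civita connection in the left trivialization. -/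
def coeff (a b : HH) : HH :=
  (cross a.1 b.1 + (1 / 3 : ℝ) • (cross a.2 b.1 - cross a.1 b.2),
    cross a.2 b.2 + (1 / 3 : ℝ) • (cross a.1 b.2 - cross a.2 b.1))

/-- The Levi-Civita connection in the left trivialization. -/
def connFormula (X Y : HH → HH) (x : HH) : HH :=
  leftMul x (fderiv ℝ (fun y => leftTriv y (Y y)) x (X x)
    + coeff (leftTriv x (X x)) (leftTriv x (Y x)))

lemma ne_zero_of_mem {x : HH} (hx : x ∈ S3xS3) : x.1 ≠ 0 ∧ x.2 ≠ 0 := by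
  constructor
  · intro h; have := hx.1; simp [h] at this
  · intro h; have := hx.2; simp [h] at this

lemma leftMul_leftTriv {x : HH} (hx : x ∈ S3xS3) (U : HH) : leftMul x (leftTriv x U) = U := by
  obtain ⟨h1, h2⟩ := ne_zero_of_mem hx
  ext1 <;> simp [leftMul, leftTriv, h1, h2]

lemma leftTriv_leftMul {x : HH} (hx : x ∈ S3xS3) (a : HH) : leftTriv x (leftMul x a) = a := by
  obtain ⟨h1, h2⟩ := ne_zero_of_mem hx
  ext1 <;> simp [leftMul, leftTriv, h1, h2]

lemma inner_mul_left_of_norm {p : ℍ} (hp : ‖p‖ = 1) (a b : ℍ) :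
    inner ℝ (p * a) (p * b) = inner ℝ a b := by
  have h : Quaternion.normSq p = 1 := by rw [Quaternion.normSq_eq_norm_mul_self, hp]; norm_num
  rw [Quaternion.normSq_def'] at h
  have : inner ℝ (p * a) (p * b)
      = (p.re ^ 2 + p.imI ^ 2 + p.imJ ^ 2 + p.imK ^ 2) * inner ℝ a b := by
    simp only [Quaternion.inner_def, Quaternion.re_mul, Quaternion.imI_mul, Quaternion.imJ_mul,
      Quaternion.imK_mul, Quaternion.re_star, Quaternion.imI_star, Quaternion.imJ_star,
      Quaternion.imK_star]
    ring
  rw [this, h, one_mul]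

/-- `g` in the left trivialization. -/
def metric0 (a b : HH) : ℝ :=
  4 / 3 * (inner ℝ a.1 b.1 + inner ℝ a.2 b.2) - 2 / 3 * (inner ℝ a.1 b.2 + inner ℝ a.2 b.1)

lemma nkJ_leftMul {x : HH} (hx : x ∈ S3xS3) (a : HH) :
    nkJ x (leftMul x a) = leftMul x ((1 / Real.sqrt 3) • ((2 : ℝ) • a.2 - a.1),
      (1 / Real.sqrt 3) • (-((2 : ℝ) • a.1) + a.2)) := by
  obtain ⟨h1, h2⟩ := ne_zero_of_mem hx
  ext1 <;> simp [nkJ, leftMul, mul_assoc, h1, h2, mul_add, mul_sub]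

lemma nkMetric_leftMul {x : HH} (hx : x ∈ S3xS3) (a b : HH) :
    nkMetric x (leftMul x a) (leftMul x b) = metric0 a b := by
  simp only [nkMetric, stdMetric, nkJ_leftMul hx]
  simp only [leftMul, inner_mul_left_of_norm hx.1, inner_mul_left_of_norm hx.2, metric0,
    inner_smul_left, inner_smul_right, inner_add_left, inner_add_right, inner_sub_left,
    inner_sub_right, inner_neg_left, inner_neg_right]
  simp only [RCLike.conj_to_real]
  ring_nf
  have h4 : (Real.sqrt 3)⁻¹ ^ 2 = 1 / 3 := by
    rw [inv_pow, Real.sq_sqrt (by norm_num)]; norm_num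
  simp only [h4]
  ring

lemma nkMetric_eq {x : HH} (hx : x ∈ S3xS3) (U V : HH) :
    nkMetric x U V = metric0 (leftTriv x U) (leftTriv x V) := by
  rw [← nkMetric_leftMul hx, leftMul_leftTriv hx, leftMul_leftTriv hx]

lemma metric0_coeff (a b c : HH) :
    metric0 (coeff a b) c + metric0 b (coeff a c) = 0 := by
  simp only [metric0, coeff, cross, Quaternion.inner_def, Quaternion.re_mul, Quaternion.imI_mul,
    Quaternion.imJ_mul, Quaternion.imK_mul, Quaternion.re_star, Quaternion.imI_star,
    Quaternion.imJ_star, Quaternion.imK_star, Quaternion.re_add, Quaternion.imI_add,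
    Quaternion.imJ_add, Quaternion.imK_add, Quaternion.re_sub, Quaternion.imI_sub,
    Quaternion.imJ_sub, Quaternion.imK_sub, Quaternion.re_smul, Quaternion.imI_smul,
    Quaternion.imJ_smul, Quaternion.imK_smul, smul_eq_mul]
  ring

lemma coeff_sub (a b : HH) : coeff a b - coeff b a = a * b - b * a := by
  ext1 <;> simp only [coeff, cross, Prod.fst_sub, Prod.snd_sub, Prod.fst_mul, Prod.snd_mul] <;>
    module

lemma coeff_re (a b : HH) : (coeff a b).1.re = 0 ∧ (coeff a b).2.re = 0 := by
  simp only [coeff, cross, Quaternion.re_add, Quaternion.re_sub, Quaternion.re_smul,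
    Quaternion.re_mul, smul_eq_mul]
  constructor <;> ring

lemma metric0_self_pos {a : HH} (h : metric0 a a = 0) : a = 0 := by
  have e : metric0 a a = 1 / 3 * (inner ℝ (a.1 - a.2) (a.1 - a.2)) * 2
      + 2 / 3 * (inner ℝ a.1 a.1 + inner ℝ a.2 a.2) := by
    simp only [metric0, inner_sub_left, inner_sub_right, real_inner_comm]; ring
  rw [h] at e
  simp only [real_inner_self_eq_norm_sq] at e
  have h1 : ‖a.1‖ ^ 2 = 0 := by nlinarith [sq_nonneg ‖a.1 - a.2‖, sq_nonneg ‖a.1‖, sq_nonneg ‖a.2‖]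
  have h2 : ‖a.2‖ ^ 2 = 0 := by nlinarith [sq_nonneg ‖a.1 - a.2‖, sq_nonneg ‖a.1‖, sq_nonneg ‖a.2‖]
  ext1
  · simpa using h1
  · simpa using h2

lemma isTangent_leftMul_iff {x : HH} (hx : x ∈ S3xS3) (a : HH) :
    IsTangent x (leftMul x a) ↔ a.1.re = 0 ∧ a.2.re = 0 := by
  have k : ∀ {p : ℍ}, ‖p‖ = 1 → ∀ b : ℍ, inner ℝ p (p * b) = b.re := by
    intro p hp b
    have := inner_mul_left_of_norm hp 1 b
    rw [mul_one] at this
    rw [this]; simp [Quaternion.inner_def]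
  simp only [IsTangent, leftMul, k hx.1, k hx.2]

lemma re_leftTriv {x : HH} (hx : x ∈ S3xS3) {U : HH} (hU : IsTangent x U) :
    (leftTriv x U).1.re = 0 ∧ (leftTriv x U).2.re = 0 := by
  rwa [← isTangent_leftMul_iff hx, leftMul_leftTriv hx]

lemma leftInv_isVectorField {a : HH} (h1 : a.1.re = 0) (h2 : a.2.re = 0) :
    IsVectorField (leftInv a) where
  smooth x _ := by
    unfold leftInv leftMul
    exact ((contDiff_fst.mul contDiff_const).prodMk (contDiff_snd.mul contDiff_const)).contDiffAt
  tangent x hx := (isTangent_leftMul_iff hx a).2 ⟨h1, h2⟩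

lemma contDiffAt_leftTriv {x : HH} (hx : x ∈ S3xS3) {Y : HH → HH} (hY : ContDiffAt ℝ ∞ Y x) :
    ContDiffAt ℝ ∞ (fun y => leftTriv y (Y y)) x := by
  obtain ⟨h1, h2⟩ := ne_zero_of_mem hx
  unfold leftTriv
  have k : ∀ {p : ℍ}, p ≠ 0 → ContDiffAt ℝ ∞ (fun z : ℍ => z⁻¹) p := by
    intro p hp
    have := contDiffAt_ringInverse ℝ (n := ∞) (Units.mk0 p hp)
    rwa [Ring.inverse_eq_inv'] at this
  have e1 : ContDiffAt ℝ ∞ (fun y : HH => y.1⁻¹) x :=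
    ContDiffAt.comp (f := Prod.fst) (g := fun z : ℍ => z⁻¹) x (k h1) contDiffAt_fst
  have e2 : ContDiffAt ℝ ∞ (fun y : HH => y.2⁻¹) x :=
    ContDiffAt.comp (f := Prod.snd) (g := fun z : ℍ => z⁻¹) x (k h2) contDiffAt_snd
  exact (e1.mul hY.fst).prodMk (e2.mul hY.snd)

/-- The derivative along `S³ × S³` only sees the values on `S³ × S³`. -/
lemma fderiv_congr {F : Type*} [NormedAddCommGroup F] [NormedSpace ℝ F] {φ ψ : HH → F} {x u : HH}
    (hx : x ∈ S3xS3) (hu : IsTangent x u) (hφ : DifferentiableAt ℝ φ x)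
    (hψ : DifferentiableAt ℝ ψ x) (h : ∀ y ∈ S3xS3, φ y = ψ y) :
    fderiv ℝ φ x u = fderiv ℝ ψ x u := by
  have key : ∀ p U : ℍ, ‖p‖ = 1 → inner ℝ p U = 0 → ∃ c : ℝ → ℍ, c 0 = p ∧ HasDerivAt c U 0 ∧
      ∀ t, ‖c t‖ = 1 := by
    intro p U hp hU
    have hn : ∀ t : ℝ, ‖p + t • U‖ ^ 2 = 1 + t ^ 2 * ‖U‖ ^ 2 := by
      intro t
      rw [norm_add_sq_real, inner_smul_right, hU, hp, norm_smul, mul_pow]; simp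
    have hn' : ∀ t : ℝ, ‖p + t • U‖ = Real.sqrt (1 + t ^ 2 * ‖U‖ ^ 2) := by
      intro t; rw [← hn, Real.sqrt_sq (norm_nonneg _)]
    have hpos : ∀ t : ℝ, 0 < 1 + t ^ 2 * ‖U‖ ^ 2 := fun t => by positivity
    refine ⟨fun t => (Real.sqrt (1 + t ^ 2 * ‖U‖ ^ 2))⁻¹ • (p + t • U), by simp, ?_, ?_⟩
    · have d1 : HasDerivAt (fun t : ℝ => 1 + t ^ 2 * ‖U‖ ^ 2) 0 0 := by
        have := ((hasDerivAt_pow 2 (0 : ℝ)).mul_const (‖U‖ ^ 2)).const_add 1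
        simpa using this
      have d2 := (d1.sqrt (hpos 0).ne').inv (by
        rw [Real.sqrt_ne_zero']; exact hpos 0)
      have d3 : HasDerivAt (fun t : ℝ => p + t • U) U 0 := by
        have := ((hasDerivAt_id (0 : ℝ)).smul_const U).const_add p
        simpa using this
      have d4 := d2.smul d3
      have d5 : (fun t : ℝ => (Real.sqrt (1 + t ^ 2 * ‖U‖ ^ 2))⁻¹ • (p + t • U))
          = (fun t : ℝ => Real.sqrt (1 + t ^ 2 * ‖U‖ ^ 2))⁻¹ • fun t : ℝ => p + t • U := rfl
      rw [d5]
      simpa using d4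
    · intro t
      rw [norm_smul, hn', norm_inv, Real.norm_eq_abs, abs_of_nonneg (Real.sqrt_nonneg _)]
      exact inv_mul_cancel₀ (by rw [Real.sqrt_ne_zero']; exact hpos t)
  obtain ⟨c, c0, cd, cn⟩ := key x.1 u.1 hx.1 hu.1
  obtain ⟨d, d0, dd, dn⟩ := key x.2 u.2 hx.2 hu.2
  have hcd : HasDerivAt (fun t => (c t, d t)) u 0 := cd.prodMk dd
  have h0 : (c 0, d 0) = x := by rw [c0, d0]
  have e1 : HasDerivAt (fun t => φ (c t, d t)) (fderiv ℝ φ x u) 0 := by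
    have : HasFDerivAt φ (fderiv ℝ φ x) (c 0, d 0) := by rw [h0]; exact hφ.hasFDerivAt
    exact this.comp_hasDerivAt 0 hcd
  have e2 : HasDerivAt (fun t => ψ (c t, d t)) (fderiv ℝ ψ x u) 0 := by
    have : HasFDerivAt ψ (fderiv ℝ ψ x) (c 0, d 0) := by rw [h0]; exact hψ.hasFDerivAt
    exact this.comp_hasDerivAt 0 hcd
  have e3 : (fun t => φ (c t, d t)) = fun t => ψ (c t, d t) := by
    funext t; exact h _ ⟨cn t, dn t⟩
  rw [e3] at e1
  exact e1.unique e2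

lemma coeff_add_left (a a' b : HH) : coeff (a + a') b = coeff a b + coeff a' b := by
  ext1 <;> simp only [coeff, cross, Prod.fst_add, Prod.snd_add, add_mul, mul_add] <;> module

lemma coeff_add_right (a b b' : HH) : coeff a (b + b') = coeff a b + coeff a b' := by
  ext1 <;> simp only [coeff, cross, Prod.fst_add, Prod.snd_add, add_mul, mul_add] <;> module

lemma coeff_smul_left (r : ℝ) (a b : HH) : coeff (r • a) b = r • coeff a b := by
  ext1 <;> simp only [coeff, cross, Prod.smul_fst, Prod.smul_snd, smul_mul_assoc, mul_smul_comm] <;>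
    module

lemma coeff_smul_right (r : ℝ) (a b : HH) : coeff a (r • b) = r • coeff a b := by
  ext1 <;> simp only [coeff, cross, Prod.smul_fst, Prod.smul_snd, smul_mul_assoc, mul_smul_comm] <;>
    module

lemma leftTriv_add (x U V : HH) : leftTriv x (U + V) = leftTriv x U + leftTriv x V := by
  ext1 <;> simp [leftTriv, mul_add]

lemma leftTriv_smul (x : HH) (r : ℝ) (U : HH) : leftTriv x (r • U) = r • leftTriv x U := by
  ext1 <;> simp [leftTriv]

lemma leftMul_add (x a b : HH) : leftMul x (a + b) = leftMul x a + leftMul x b := by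
  ext1 <;> simp [leftMul, mul_add]

lemma leftMul_smul (x : HH) (r : ℝ) (a : HH) : leftMul x (r • a) = r • leftMul x a := by
  ext1 <;> simp [leftMul]

lemma IsVectorField.differentiableAt_leftTriv {Y : HH → HH} (hY : IsVectorField Y) {x : HH}
    (hx : x ∈ S3xS3) : DifferentiableAt ℝ (fun y => leftTriv y (Y y)) x :=
  (contDiffAt_leftTriv hx (hY.smooth x hx)).differentiableAt (by simp)

lemma fderiv_eq_leftMul {Y : HH → HH} (hY : IsVectorField Y) {x u : HH} (hx : x ∈ S3xS3)
    (hu : IsTangent x u) :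
    fderiv ℝ Y x u = leftMul x (leftTriv x u * leftTriv x (Y x)
      + fderiv ℝ (fun y => leftTriv y (Y y)) x u) := by
  have hd := hY.differentiableAt_leftTriv hx
  set y := fun y => leftTriv y (Y y) with hy
  have e : fderiv ℝ Y x u = fderiv ℝ (fun z => z * y z) x u := by
    refine fderiv_congr hx hu ((hY.smooth x hx).differentiableAt (by simp)) (by fun_prop) ?_
    intro z hz
    exact (leftMul_leftTriv hz (Y z)).symm
  have e2 : HasFDerivAt (fun z => z * y z) _ x := (hasFDerivAt_id (𝕜 := ℝ) x).mul' hd.hasFDerivAt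
  rw [e, e2.fderiv]
  have hu' : u = x * leftTriv x u := (leftMul_leftTriv hx u).symm
  change x * fderiv ℝ y x u + u * y x = x * (leftTriv x u * leftTriv x (Y x) + fderiv ℝ y x u)
  rw [mul_add, ← mul_assoc, ← hu', add_comm]

lemma fderiv_metric0 {a b : HH → HH} {x : HH} (ha : DifferentiableAt ℝ a x)
    (hb : DifferentiableAt ℝ b x) (u : HH) :
    DifferentiableAt ℝ (fun y => metric0 (a y) (b y)) x ∧
    fderiv ℝ (fun y => metric0 (a y) (b y)) x u
      = metric0 (fderiv ℝ a x u) (b x) + metric0 (a x) (fderiv ℝ b x u) := by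
  have a1 := ha.hasFDerivAt.fst
  have a2 := ha.hasFDerivAt.snd
  have b1 := hb.hasFDerivAt.fst
  have b2 := hb.hasFDerivAt.snd
  have h := ((((a1.inner ℝ b1).add (a2.inner ℝ b2)).const_mul (4 / 3)).sub
    (((a1.inner ℝ b2).add (a2.inner ℝ b1)).const_mul (2 / 3)))
  have h' : HasFDerivAt (fun y => metric0 (a y) (b y)) _ x := h
  refine ⟨h'.differentiableAt, ?_⟩
  rw [h'.fderiv]
  simp [metric0]
  ring

lemma metric0_add_left (a a' b : HH) : metric0 (a + a') b = metric0 a b + metric0 a' b := by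
  simp only [metric0, Prod.fst_add, Prod.snd_add, inner_add_left]; ring

lemma metric0_add_right (a b b' : HH) : metric0 a (b + b') = metric0 a b + metric0 a b' := by
  simp only [metric0, Prod.fst_add, Prod.snd_add, inner_add_right]; ring

lemma metric0_comm (a b : HH) : metric0 a b = metric0 b a := by
  simp only [metric0, real_inner_comm]; ring

lemma IsVectorField.add {X Y : HH → HH} (hX : IsVectorField X) (hY : IsVectorField Y) :
    IsVectorField (fun y => X y + Y y) where
  smooth x hx := (hX.smooth x hx).add (hY.smooth x hx)
  tangent x hx := by
    have h1 := hX.tangent x hx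
    have h2 := hY.tangent x hx
    simp [IsTangent, inner_add_right, h1.1, h1.2, h2.1, h2.2]

lemma differentiableAt_nkMetric {Y Z : HH → HH} (hY : IsVectorField Y) (hZ : IsVectorField Z)
    {x : HH} (hx : x ∈ S3xS3) : DifferentiableAt ℝ (fun y => nkMetric y (Y y) (Z y)) x := by
  have key : ∀ {Y : HH → HH}, IsVectorField Y →
      DifferentiableAt ℝ (fun y => nkJ y (Y y)) x := by
    intro Y hY
    have h1 := (hY.smooth x hx).differentiableAt (n := ∞) (by simp)
    have h2 := hY.differentiableAt_leftTriv hx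
    have h3 : DifferentiableAt ℝ (fun y => (leftTriv y (Y y)).1) x := h2.fst
    have h4 : DifferentiableAt ℝ (fun y => (leftTriv y (Y y)).2) x := h2.snd
    have e : (fun y => nkJ y (Y y)) = fun y =>
        ((1 / Real.sqrt 3) • ((2 : ℝ) • (y.1 * (leftTriv y (Y y)).2) - (Y y).1),
          (1 / Real.sqrt 3) • (-((2 : ℝ) • (y.2 * (leftTriv y (Y y)).1)) + (Y y).2)) := by
      funext y; simp only [nkJ, leftTriv, mul_assoc]
    rw [e]
    fun_prop
  have hY1 := (hY.smooth x hx).differentiableAt (n := ∞) (by simp)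
  have hZ1 := (hZ.smooth x hx).differentiableAt (n := ∞) (by simp)
  have k1 := key hY
  have k2 := key hZ
  have i1 := hY1.fst.inner ℝ hZ1.fst
  have i2 := hY1.snd.inner ℝ hZ1.snd
  have i3 := k1.fst.inner ℝ k2.fst
  have i4 := k1.snd.inner ℝ k2.snd
  exact ((i1.add i2).add (i3.add i4)).const_mul (1 / 2)

theorem connFormula_isLeviCivita : IsLeviCivita connFormula where
  tangent X Y hX hY x hx := by
    have hd := hY.differentiableAt_leftTriv hx
    have r1 : ∀ (L : HH →L[ℝ] ℝ), (∀ y ∈ S3xS3, L (leftTriv y (Y y)) = 0) →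
        L (fderiv ℝ (fun y => leftTriv y (Y y)) x (X x)) = 0 := by
      intro L hL
      have h1 := (L.hasFDerivAt.comp x hd.hasFDerivAt)
      have h2 := fderiv_congr (φ := fun y => L (leftTriv y (Y y))) (ψ := fun _ => 0) hx
        (hX.tangent x hx) h1.differentiableAt (differentiableAt_const _) hL
      have h3 : fderiv ℝ (fun y => L (leftTriv y (Y y))) x = _ := h1.fderiv
      rw [h3] at h2
      simpa using h2
    have c := coeff_re (leftTriv x (X x)) (leftTriv x (Y x))
    refine (isTangent_leftMul_iff hx _).2 ⟨?_, ?_⟩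
    · have := r1 ((innerSL ℝ (1 : ℍ)).comp (ContinuousLinearMap.fst ℝ ℍ ℍ)) (fun y hy => by
        simpa [Quaternion.inner_def] using (re_leftTriv hy (hY.tangent y hy)).1)
      simpa [Quaternion.inner_def, c.1] using this
    · have := r1 ((innerSL ℝ (1 : ℍ)).comp (ContinuousLinearMap.snd ℝ ℍ ℍ)) (fun y hy => by
        simpa [Quaternion.inner_def] using (re_leftTriv hy (hY.tangent y hy)).2)
      simpa [Quaternion.inner_def, c.2] using this
  add_left X X' Y _ _ _ x _ := by
    simp only [connFormula, map_add, leftTriv_add, coeff_add_left, ← leftMul_add]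
    congr 1; abel
  smul_left φ X Y _ _ _ x _ := by
    simp only [connFormula, map_smul, leftTriv_smul, coeff_smul_left, ← leftMul_smul, smul_add]
  add_right X Y Y' _ hY hY' x hx := by
    have h := (hY.differentiableAt_leftTriv hx).hasFDerivAt.add
      (hY'.differentiableAt_leftTriv hx).hasFDerivAt
    have e0 : (fun y => leftTriv y (Y y + Y' y))
        = (fun y => leftTriv y (Y y)) + fun y => leftTriv y (Y' y) := by
      funext y; exact leftTriv_add _ _ _
    have e := h.fderiv
    rw [← e0] at e
    simp only [connFormula]
    rw [e]
    simp only [leftTriv_add, coeff_add_right, ← leftMul_add]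
    congr 1
    rw [add_apply]
    abel
  leibniz φ X Y hφ _ hY x hx := by
    have h := ((hφ x hx).differentiableAt (by simp)).hasFDerivAt.smul
      (hY.differentiableAt_leftTriv hx).hasFDerivAt
    have e0 : (fun y => leftTriv y (φ y • Y y)) = φ • fun y => leftTriv y (Y y) := by
      funext y; exact leftTriv_smul _ _ _
    have e := h.fderiv
    rw [← e0] at e
    simp only [connFormula]
    rw [e]
    simp only [leftTriv_smul, coeff_smul_right]
    rw [← leftMul_smul, ← leftMul_leftTriv hx (fderiv ℝ φ x (X x) • Y x), ← leftMul_add]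
    congr 1
    simp [leftTriv_smul]
    abel
  torsion_free X Y hX hY x hx := by
    rw [fderiv_eq_leftMul hY hx (hX.tangent x hx), fderiv_eq_leftMul hX hx (hY.tangent x hx)]
    have c := coeff_sub (leftTriv x (X x)) (leftTriv x (Y x))
    have m : ∀ a b : HH, leftMul x a - leftMul x b = leftMul x (a - b) := by
      intro a b; ext1 <;> simp [leftMul, mul_sub]
    simp only [connFormula, m]
    congr 1
    rw [add_sub_add_comm, c]
    abel
  metric X Y Z hX hY hZ x hx := by
    have dY := hY.differentiableAt_leftTriv hx
    have dZ := hZ.differentiableAt_leftTriv hx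
    obtain ⟨h1, h2⟩ := fderiv_metric0 dY dZ (X x)
    rw [fderiv_congr hx (hX.tangent x hx) (differentiableAt_nkMetric hY hZ hx) h1
      (fun y hy => nkMetric_eq hy _ _), h2]
    simp only [nkMetric_eq hx, connFormula, leftTriv_leftMul hx, metric0_add_left,
      metric0_add_right]
    have := metric0_coeff (leftTriv x (X x)) (leftTriv x (Y x)) (leftTriv x (Z x))
    linarith

/-- Existence half of the fundamental theorem of Riemannian geometry, for `g`. -/
theorem exists_isLeviCivita : ∃ D, IsLeviCivita D := ⟨connFormula, connFormula_isLeviCivita⟩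

/-- Uniqueness half: on vector fields, any two Levi-Civita connections agree along `S³ × S³`. -/
theorem IsLeviCivita.unique {D D' : (HH → HH) → (HH → HH) → HH → HH} (hD : IsLeviCivita D)
    (hD' : IsLeviCivita D') {X Y : HH → HH} (hX : IsVectorField X) (hY : IsVectorField Y) {x : HH}
    (hx : x ∈ S3xS3) : D X Y x = D' X Y x := by
  -- the difference tensor `E` is symmetric in its two arguments and skew with respect to `g`
  have symm : ∀ X Y, IsVectorField X → IsVectorField Y →
      D X Y x - D' X Y x = D Y X x - D' Y X x := by
    intro X Y hX hY
    have h1 := hD.torsion_free X Y hX hY x hx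
    have h2 := hD'.torsion_free X Y hX hY x hx
    rw [← h2] at h1
    rw [sub_eq_sub_iff_add_eq_add] at h1 ⊢
    rw [h1]; abel
  have skew : ∀ X Y Z, IsVectorField X → IsVectorField Y → IsVectorField Z →
      metric0 (leftTriv x (D X Y x - D' X Y x)) (leftTriv x (Z x))
        = - metric0 (leftTriv x (D X Z x - D' X Z x)) (leftTriv x (Y x)) := by
    intro X Y Z hX hY hZ
    have h1 := hD.metric X Y Z hX hY hZ x hx
    have h2 := hD'.metric X Y Z hX hY hZ x hx
    rw [h1] at h2
    simp only [nkMetric_eq hx] at h2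
    have s : ∀ U V, leftTriv x (U - V) = leftTriv x U + (-1 : ℝ) • leftTriv x V := by
      intro U V; rw [sub_eq_add_neg, ← neg_one_smul ℝ V, leftTriv_add, leftTriv_smul]
    have n : ∀ a b, metric0 ((-1 : ℝ) • a) b = - metric0 a b := by
      intro a b; simp [metric0]; ring
    simp only [s, metric0_add_left, n]
    rw [metric0_comm (leftTriv x (Y x)) (leftTriv x (D X Z x)),
      metric0_comm (leftTriv x (Y x)) (leftTriv x (D' X Z x))] at h2
    linarith
  have zero : ∀ Z, IsVectorField Z →
      metric0 (leftTriv x (D X Y x - D' X Y x)) (leftTriv x (Z x)) = 0 := by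
    intro Z hZ
    have h1 := skew X Y Z hX hY hZ
    have h2 := skew Z X Y hZ hX hY
    have h3 := skew Y Z X hY hZ hX
    rw [symm X Z hX hZ] at h1
    rw [symm Z Y hZ hY] at h2
    rw [symm Y X hY hX] at h3
    linarith
  obtain ⟨t1, t2⟩ := re_leftTriv hx (hD.tangent X Y hX hY x hx)
  obtain ⟨t3, t4⟩ := re_leftTriv hx (hD'.tangent X Y hX hY x hx)
  set a := leftTriv x (D X Y x - D' X Y x) with ha
  have ha1 : a = leftTriv x (D X Y x) - leftTriv x (D' X Y x) := by
    ext1 <;> simp [ha, leftTriv, mul_sub]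
  have hZ : IsVectorField (leftInv a) := by
    apply leftInv_isVectorField
    · rw [ha1]; simp [t1, t3]
    · rw [ha1]; simp [t2, t4]
  have h0 := zero _ hZ
  rw [show leftTriv x (leftInv a x) = a from leftTriv_leftMul hx a] at h0
  have h5 := metric0_self_pos h0
  have h6 : D X Y x - D' X Y x = 0 := by
    rw [← leftMul_leftTriv hx (D X Y x - D' X Y x), ← ha, h5]
    ext1 <;> simp [leftMul]
  exact sub_eq_zero.1 h6

/-- The Levi-Civita connection `∇̃` of `g`; `leviCivita X Y` is `∇̃_X Y`. -/
def leviCivita : (HH → HH) → (HH → HH) → HH → HH := Classical.choose exists_isLeviCivita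

theorem leviCivita_spec : IsLeviCivita leviCivita := Classical.choose_spec exists_isLeviCivita

theorem leviCivita_eq_connFormula {X Y : HH → HH} (hX : IsVectorField X) (hY : IsVectorField Y)
    {x : HH} (hx : x ∈ S3xS3) : leviCivita X Y x = connFormula X Y x :=
  leviCivita_spec.unique connFormula_isLeviCivita hX hY hx

/-- The tensor field `G = ∇̃ J`, i.e. `G(u, v) = (∇̃_u J) v = ∇̃_X (J Y) - J ∇̃_X Y` for vector fields
`X`, `Y` extending the tangent vectors `u`, `v` at `x`; the left-invariant extensions are used. -/
def nkG (x u v : HH) : HH :=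
  leviCivita (leftInv (leftTriv x u)) (fun y => nkJ y (leftInv (leftTriv x v) y)) x
    - nkJ x (leviCivita (leftInv (leftTriv x u)) (leftInv (leftTriv x v)) x)

/-! ### Lagrangian immersions -/

/-- A map into `S³ × S³`, regarded as a map into `ℍ × ℍ`. -/
def emb {M : Type*} (f : M → S3 × S3) (m : M) : HH := ((f m).1, (f m).2)

lemma emb_mem {M : Type*} (f : M → S3 × S3) (m : M) : emb f m ∈ S3xS3 :=
  ⟨mem_sphere_zero_iff_norm.1 (f m).1.2, mem_sphere_zero_iff_norm.1 (f m).2.2⟩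

variable {M : Type*} [TopologicalSpace M] [ChartedSpace (EuclideanSpace ℝ (Fin 3)) M]

/-- The differential `df_m : T_m M → T_{f m} (S³ × S³) ⊆ ℍ × ℍ`. -/
def dmap (f : M → S3 × S3) (m : M) (v : TangentSpace (𝓡 3) m) : HH :=
  mfderiv (𝓡 3) 𝓘(ℝ, HH) (emb f) m v

/-- A smooth immersion `f : M³ → S³ × S³` is Lagrangian: `J` maps the tangent spaces of `M`
onto its normal spaces. -/
structure IsLagrangianImmersion (f : M → S3 × S3) : Prop where
  smooth : ContMDiff (𝓡 3) ((𝓡 3).prod (𝓡 3)) ∞ f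
  immersion : ∀ m, Function.Injective (dmap f m)
  lagrangian : ∀ m, ∀ ξ : HH, (∃ u : TangentSpace (𝓡 3) m, ξ = nkJ (emb f m) (dmap f m u)) ↔
    (IsTangent (emb f m) ξ ∧ ∀ w : TangentSpace (𝓡 3) m, nkMetric (emb f m) ξ (dmap f m w) = 0)

/-- Smooth vector fields on `M`. -/
def IsSmoothField [IsManifold (𝓡 3) ∞ M] (X : ∀ m : M, TangentSpace (𝓡 3) m) : Prop :=
  ContMDiff (𝓡 3) (𝓡 3).tangent ∞ (fun m => (⟨m, X m⟩ : TangentBundle (𝓡 3) M))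

/-- Every tangent vector of `M` extends to a smooth vector field on `M`. -/
lemma exists_isSmoothField [IsManifold (𝓡 3) ∞ M] [T2Space M] (m : M) (v : TangentSpace (𝓡 3) m) :
    ∃ X : ∀ m : M, TangentSpace (𝓡 3) m, IsSmoothField X ∧ X m = v := by
  have : IsManifold (𝓡 3) (∞ + 1) M := ‹IsManifold (𝓡 3) ∞ M›
  obtain ⟨s, hs, hX⟩ := FiberBundle.exists_contMDiffOn_extend (k := ∞) (𝓡 3)
    (EuclideanSpace ℝ (Fin 3)) v
  obtain ⟨φ, -, hφ⟩ := (SmoothBumpFunction.nhds_basis_tsupport (I := 𝓡 3) m).mem_iff.1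
    (interior_mem_nhds.2 hs)
  refine ⟨(φ : M → ℝ) • FiberBundle.extend (EuclideanSpace ℝ (Fin 3)) v, ?_, ?_⟩
  · exact ContMDiffOn.smul_section_of_tsupport φ.contMDiff.contMDiffOn isOpen_interior hφ
      (hX.mono interior_subset)
  · simp

/-- The pull-back by `f` of the Levi-Civita connection: `∇̃_v V` for `v ∈ T_m M` and a vector field
`V` along `f`. In terms of a left-invariant frame `E_a` of `S³ × S³`, if `V = ∑ V^a E_a`
then `∇̃_v V = ∑ (v V^a) E_a + ∑ V^a ∇̃_{df v} E_a`. -/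
def pullConn (f : M → S3 × S3) (m : M) (v : TangentSpace (𝓡 3) m) (V : M → HH) : HH :=
  leftMul (emb f m) (mfderiv (𝓡 3) 𝓘(ℝ, HH) (fun m' => leftTriv (emb f m') (V m')) m v)
    + leviCivita (leftInv (leftTriv (emb f m) (dmap f m v)))
        (leftInv (leftTriv (emb f m) (V m))) (emb f m)

/-- `pullConn` is the pull-back connection: on the restriction to `M` of a vector field `Y` of
`S³ × S³` it is `∇̃_X Y`, where `X` extends `df v`. -/
theorem pullConn_comp (f : M → S3 × S3) (m : M) (v : TangentSpace (𝓡 3) m)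
    (hf : MDifferentiableAt (𝓡 3) 𝓘(ℝ, HH) (emb f) m) {X Y : HH → HH} (hX : IsVectorField X)
    (hY : IsVectorField Y) (hv : X (emb f m) = dmap f m v) :
    pullConn f m v (fun m' => Y (emb f m')) = leviCivita X Y (emb f m) := by
  have hx := emb_mem f m
  have r1 := re_leftTriv hx (hX.tangent _ hx)
  have r2 := re_leftTriv hx (hY.tangent _ hx)
  have e : ∀ w : TangentSpace (𝓡 3) m,
      mfderiv (𝓡 3) 𝓘(ℝ, HH) (fun m' => leftTriv (emb f m') (Y (emb f m'))) m w
        = fderiv ℝ (fun y => leftTriv y (Y y)) (emb f m) (dmap f m w) := by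
    intro w
    have := mfderiv_comp (I := 𝓡 3) (I' := 𝓘(ℝ, HH)) (I'' := 𝓘(ℝ, HH)) m
      (hY.differentiableAt_leftTriv hx).mdifferentiableAt hf
    rw [mfderiv_eq_fderiv] at this
    exact congrArg (fun L => L w) this
  have k : ∀ {a b : HH}, a.1.re = 0 ∧ a.2.re = 0 → b.1.re = 0 ∧ b.2.re = 0 →
      leviCivita (leftInv a) (leftInv b) (emb f m) = leftMul (emb f m) (coeff a b) := by
    intro a b ha hb
    have hb' := leftInv_isVectorField hb.1 hb.2
    rw [leviCivita_eq_connFormula (leftInv_isVectorField ha.1 ha.2) hb' hx]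
    have hz := fderiv_congr (φ := fun y => leftTriv y (leftInv b y)) (ψ := fun _ => b) hx
      ((leftInv_isVectorField ha.1 ha.2).tangent _ hx) (hb'.differentiableAt_leftTriv hx)
      (differentiableAt_const _) (fun y hy => leftTriv_leftMul hy b)
    simp only [connFormula]
    rw [hz]
    simp [leftInv, leftTriv_leftMul hx]
  unfold pullConn
  rw [← hv, k r1 r2, e v, ← hv, leviCivita_eq_connFormula hX hY hx, connFormula, leftMul_add]

open Classical in
/-- The tangential part of `ξ ∈ T_{f m} (S³ × S³)`, as an element of `T_m M`: the vector `u` such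
that `ξ - df u` is `g`-orthogonal to the tangent space of `M`. -/
def tanPart (f : M → S3 × S3) (m : M) (ξ : HH) : TangentSpace (𝓡 3) m :=
  if h : ∃ u : TangentSpace (𝓡 3) m, ∀ w : TangentSpace (𝓡 3) m,
      nkMetric (emb f m) (ξ - dmap f m u) (dmap f m w) = 0
  then Classical.choose h else 0

/-- The normal part of `ξ ∈ T_{f m} (S³ × S³)`. -/
def norPart (f : M → S3 × S3) (m : M) (ξ : HH) : HH := ξ - dmap f m (tanPart f m ξ)

/-- The induced connection `∇_X Y` on `M` (Gauss formula). -/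
def indConn (f : M → S3 × S3) (X Y : ∀ m : M, TangentSpace (𝓡 3) m) (m : M) :
    TangentSpace (𝓡 3) m :=
  tanPart f m (pullConn f m (X m) (fun m' => dmap f m' (Y m')))

/-- The second fundamental form `h(X, Y)` (Gauss formula). -/
def secondFF (f : M → S3 × S3) (X Y : ∀ m : M, TangentSpace (𝓡 3) m) (m : M) : HH :=
  norPart f m (pullConn f m (X m) (fun m' => dmap f m' (Y m')))

/-- The normal connection `∇^⊥_X ξ` (Weingarten formula). -/
def norConn (f : M → S3 × S3) (X : ∀ m : M, TangentSpace (𝓡 3) m) (ξ : M → HH) (m : M) : HH :=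
  norPart f m (pullConn f m (X m) ξ)

/-- `(∇h)(X, Y, Z) = ∇^⊥_X h(Y, Z) - h(∇_X Y, Z) - h(Y, ∇_X Z)`. -/
def nablaH (f : M → S3 × S3) (X Y Z : ∀ m : M, TangentSpace (𝓡 3) m) (m : M) : HH :=
  norConn f X (secondFF f Y Z) m - secondFF f (indConn f X Y) Z m - secondFF f Y (indConn f X Z) m

/-- The cyclic sum. -/
def cyclicSum {A : Type*} (F : A → A → A → ℝ) (a b c : A) : ℝ := F a b c + F b c a + F c a b

/-- `f` is `J`-isotropic with function `lam`: `g((∇h)(v, v, v), J v) = lam(m) g(v, v)²` for every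
tangent vector `v ∈ T_m M`. The tensor `∇h` is evaluated on `v` by means of vector fields `X` on `M`
with `X m = v`. -/
def IsJIsotropicWith [IsManifold (𝓡 3) ∞ M] (f : M → S3 × S3) (lam : M → ℝ) : Prop :=
  ∀ (m : M) (v : TangentSpace (𝓡 3) m) (X : ∀ m : M, TangentSpace (𝓡 3) m),
    IsSmoothField X → X m = v →
    nkMetric (emb f m) (nablaH f X X X m) (nkJ (emb f m) (dmap f m v)) =
      lam m * (nkMetric (emb f m) (dmap f m v) (dmap f m v)) ^ 2

/-- `f` is `J`-isotropic. -/
def IsJIsotropic [IsManifold (𝓡 3) ∞ M] (f : M → S3 × S3) : Prop := ∃ lam : M → ℝ, IsJIsotropicWith f lam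

/-- The polarized identity with function `lam`, for all vector fields `Y, Z, W, V` tangent to `M`. -/
def PolarizedIdentity [IsManifold (𝓡 3) ∞ M] (f : M → S3 × S3) (lam : M → ℝ) : Prop :=
  ∀ Y Z W V : (∀ m : M, TangentSpace (𝓡 3) m),
    IsSmoothField Y → IsSmoothField Z → IsSmoothField W → IsSmoothField V → ∀ m : M,
    let g := nkMetric (emb f m)
    let J := nkJ (emb f m)
    let P := nkP (emb f m)
    let G := nkG (emb f m)
    -- `d X` is `X`, at `m`, as a tangent vector to `S³ × S³`; `h X Y` is `h(X, Y)` at `m`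
    let d := fun X : (∀ m : M, TangentSpace (𝓡 3) m) => dmap f m (X m)
    let h := fun X Y : (∀ m : M, TangentSpace (𝓡 3) m) => secondFF f X Y m
    12 * g (nablaH f Y Z W m) (J (d V))
      + 3 * cyclicSum (fun Y Z W => g (h Y Z) (G (d W) (d V))) Y Z W
      + 2 * cyclicSum (fun Z W V => g (P (d Y)) (d Z) * g (P (J (d W))) (d V)
          - g (P (J (d Y))) (d Z) * g (P (d W)) (d V)) Z W V
      - 4 * lam m * cyclicSum (fun Z W V => g (d Y) (d Z) * g (d W) (d V)) Z W V = 0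

end NKS3S3

end

/-! The argument is a polarization. For a fixed function λ, the left-hand side of the identity is a
form `polarizedForm` in four tangent fields. On the diagonal its G-terms vanish by skewness of G and
its P-terms cancel, so it equals 12 (g((∇h)(v,v,v), Jv) − λ g(v,v)²). The form is additive and
totally symmetric, hence vanishes identically as soon as it vanishes on the diagonal
(`quadriadditive_eq_zero`).

Total symmetry is the geometric content, and each adjacent transposition has its own reason.
Exchanging the first two arguments is the Codazzi equation (`codazzi`): on a Lagrangian submanifold
only the P-part of the ambient curvature survives in it, and the P-terms of the identity compensate
exactly for that. Exchanging the middle two is the symmetry of h. For the last two, the cubic form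
g(h(X,Y), JZ) is totally symmetric; differentiating it turns J into G and leaves an error g(h, G),
which the h-terms of the identity absorb by the cyclic relation `sffG_cyclic`.

All computations take place in the left trivialization. There g, J and P have constant coefficients,
the Levi-Civita connection is the derivative plus the bilinear map `coeff`, and the facts needed
about G and the curvature become polynomial identities between imaginary quaternions. The facts
about h then follow by differentiating the relations g(JX, Y) = 0 and g(G(X,Y), Z) = 0 along the
submanifold. -/

noncomputable section

set_option linter.unusedSimpArgs false

namespace NKS3S3

/-! ### The structure tensors in the left trivialization -/

/-- The tensor `√3 J` in the left trivialization. -/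
def scaledJ : HH →ₗ[ℝ] HH where
  toFun a := ((2 : ℝ) • a.2 - a.1, a.2 - (2 : ℝ) • a.1)
  map_add' a b := by ext1 <;> simp <;> abel
  map_smul' r a := by ext1 <;> simp <;> module

/-- The almost complex structure in the left trivialization. -/
def trivJ : HH →ₗ[ℝ] HH := (1 / Real.sqrt 3) • scaledJ

/-- The almost product structure in the left trivialization. -/
def trivP : HH →ₗ[ℝ] HH where
  toFun a := (a.2, a.1)
  map_add' _ _ := rfl
  map_smul' _ _ := rfl

/-- The metric in the left trivialization as a bilinear form. -/
def trivMetric : HH →ₗ[ℝ] HH →ₗ[ℝ] ℝ :=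
  LinearMap.mk₂ ℝ metric0 metric0_add_left
    (fun c a b => by
      simp only [metric0, Prod.smul_fst, Prod.smul_snd, inner_smul_left, RCLike.conj_to_real,
        smul_eq_mul]
      ring)
    metric0_add_right
    (fun c a b => by
      simp only [metric0, Prod.smul_fst, Prod.smul_snd, inner_smul_right, smul_eq_mul]
      ring)

/-- The connection coefficients as a bilinear map. -/
def trivCoeff : HH →ₗ[ℝ] HH →ₗ[ℝ] HH :=
  LinearMap.mk₂ ℝ coeff coeff_add_left coeff_smul_left coeff_add_right coeff_smul_right

/-- The tensor `√3 G` in the left trivialization. -/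
def scaledG : HH →ₗ[ℝ] HH →ₗ[ℝ] HH :=
  trivCoeff.compl₂ scaledJ - trivCoeff.compr₂ scaledJ

/-- The tensor `G = ∇̃J` in the left trivialization. -/
def trivG : HH →ₗ[ℝ] HH →ₗ[ℝ] HH := trivCoeff.compl₂ trivJ - trivCoeff.compr₂ trivJ

lemma trivCoeff_apply (a b : HH) : trivCoeff a b = coeff a b := rfl

lemma trivMetric_apply (a b : HH) : trivMetric a b = metric0 a b := rfl

lemma trivJ_apply (a : HH) : trivJ a = (1 / Real.sqrt 3) • scaledJ a := rfl

lemma scaledG_apply (a b : HH) :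
    scaledG a b = coeff a (scaledJ b) - scaledJ (coeff a b) := rfl

lemma trivG_eq (a b : HH) : trivG a b = coeff a (trivJ b) - trivJ (coeff a b) := rfl

lemma trivG_apply (a b : HH) : trivG a b = (1 / Real.sqrt 3) • scaledG a b := by
  simp only [trivG_eq, scaledG_apply, trivJ_apply, coeff_smul_right, smul_sub]

lemma inv_sqrt_three_mul_self : (1 / Real.sqrt 3) * (1 / Real.sqrt 3) = 1 / 3 := by
  rw [div_mul_div_comm, Real.mul_self_sqrt (by norm_num)]; norm_num

lemma metric0_coords (a b : HH) : metric0 a b =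
    4 / 3 * (a.1.re * b.1.re + a.1.imI * b.1.imI + a.1.imJ * b.1.imJ + a.1.imK * b.1.imK
      + (a.2.re * b.2.re + a.2.imI * b.2.imI + a.2.imJ * b.2.imJ + a.2.imK * b.2.imK))
    - 2 / 3 * (a.1.re * b.2.re + a.1.imI * b.2.imI + a.1.imJ * b.2.imJ + a.1.imK * b.2.imK
      + (a.2.re * b.1.re + a.2.imI * b.1.imI + a.2.imJ * b.1.imJ + a.2.imK * b.1.imK)) := by
  simp only [metric0, Quaternion.inner_def, Quaternion.re_mul, Quaternion.re_star,
    Quaternion.imI_star, Quaternion.imJ_star, Quaternion.imK_star]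
  ring

lemma re_cross (a b : ℍ) : (cross a b).re = 0 := by simp [cross]; ring

lemma imI_cross (a b : ℍ) : (cross a b).imI = a.imJ * b.imK - a.imK * b.imJ := by
  simp [cross]; ring

lemma imJ_cross (a b : ℍ) : (cross a b).imJ = a.imK * b.imI - a.imI * b.imK := by
  simp [cross]; ring

lemma imK_cross (a b : ℍ) : (cross a b).imK = a.imI * b.imJ - a.imJ * b.imI := by
  simp [cross]; ring

lemma fst_coeff (a b : HH) : (coeff a b).1 =
    cross a.1 b.1 + (1 / 3 : ℝ) • (cross a.2 b.1 - cross a.1 b.2) := rfl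

lemma snd_coeff (a b : HH) : (coeff a b).2 =
    cross a.2 b.2 + (1 / 3 : ℝ) • (cross a.1 b.2 - cross a.2 b.1) := rfl

lemma mul_sub_mul_eq_cross (a b : HH) :
    a * b - b * a = ((2 : ℝ) • cross a.1 b.1, (2 : ℝ) • cross a.2 b.2) := by
  ext1 <;> simp only [cross, Prod.fst_sub, Prod.snd_sub, Prod.fst_mul, Prod.snd_mul] <;> module

lemma fst_scaledJ (a : HH) : (scaledJ a).1 = (2 : ℝ) • a.2 - a.1 := rfl

lemma snd_scaledJ (a : HH) : (scaledJ a).2 = a.2 - (2 : ℝ) • a.1 := rfl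

lemma fst_trivP (a : HH) : (trivP a).1 = a.2 := rfl

lemma snd_trivP (a : HH) : (trivP a).2 = a.1 := rfl

lemma metric0_trivJ_left (a b : HH) : metric0 (trivJ a) b = - metric0 a (trivJ b) := by
  simp only [trivJ_apply, ← trivMetric_apply, map_smul, LinearMap.smul_apply]
  simp only [trivMetric_apply, metric0_coords, Prod.fst_add,
      Prod.snd_add, Prod.fst_sub, Prod.snd_sub, Prod.fst_neg, Prod.snd_neg,
      Prod.smul_fst, Prod.smul_snd, Quaternion.re_add, Quaternion.imI_add, Quaternion.imJ_add,
      Quaternion.imK_add, Quaternion.re_sub, Quaternion.imI_sub, Quaternion.imJ_sub,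
      Quaternion.imK_sub, Quaternion.re_neg, Quaternion.imI_neg, Quaternion.imJ_neg,
      Quaternion.imK_neg, Quaternion.re_smul, Quaternion.imI_smul, Quaternion.imJ_smul,
      Quaternion.imK_smul, smul_eq_mul, re_cross, imI_cross, imJ_cross, imK_cross, fst_coeff,
      snd_coeff, fst_scaledJ, snd_scaledJ, fst_trivP, snd_trivP]
  ring

lemma trivJ_trivJ (a : HH) : trivJ (trivJ a) = -a := by
  have h : scaledJ (scaledJ a) = (-3 : ℝ) • a := by
    ext1 <;> ext <;> simp [fst_scaledJ, snd_scaledJ] <;> ring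
  rw [trivJ_apply, trivJ_apply, map_smul, smul_smul, inv_sqrt_three_mul_self, h, smul_smul]
  norm_num

lemma trivP_trivJ (a : HH) : trivP (trivJ a) = - trivJ (trivP a) := by
  have h : trivP (scaledJ a) = - scaledJ (trivP a) := by
    ext1 <;> ext <;> simp [fst_scaledJ, snd_scaledJ, fst_trivP, snd_trivP]
  simp only [trivJ_apply, map_smul, h, smul_neg]

lemma metric0_trivP_left (a b : HH) : metric0 (trivP a) b = metric0 a (trivP b) := by
  simp [metric0_coords, fst_trivP, snd_trivP]; ring

lemma metric0_trivJ_trivJ (a b : HH) : metric0 (trivJ a) (trivJ b) = metric0 a b := by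
  rw [metric0_trivJ_left, trivJ_trivJ, ← trivMetric_apply, map_neg, neg_neg, trivMetric_apply]

/-- This is the nearly Kähler condition. It is checked on `scaledG`, which is free of √3, so that
`ring` suffices. -/
lemma trivG_swap (a b : HH) : trivG b a = - trivG a b := by
  have h : scaledG b a = - scaledG a b := by
    ext1 <;> ext <;> simp only [scaledG_apply, Prod.fst_add,
      Prod.snd_add, Prod.fst_sub, Prod.snd_sub, Prod.fst_neg, Prod.snd_neg,
      Prod.smul_fst, Prod.smul_snd, Quaternion.re_add, Quaternion.imI_add, Quaternion.imJ_add,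
      Quaternion.imK_add, Quaternion.re_sub, Quaternion.imI_sub, Quaternion.imJ_sub,
      Quaternion.imK_sub, Quaternion.re_neg, Quaternion.imI_neg, Quaternion.imJ_neg,
      Quaternion.imK_neg, Quaternion.re_smul, Quaternion.imI_smul, Quaternion.imJ_smul,
      Quaternion.imK_smul, smul_eq_mul, re_cross, imI_cross, imJ_cross, imK_cross, fst_coeff,
      snd_coeff, fst_scaledJ, snd_scaledJ, fst_trivP, snd_trivP] <;> ring
  simp only [trivG_apply, h, smul_neg]

/-- The covariant derivative of a skew endomorphism is again skew, because the connection is metric.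
-/
lemma metric0_trivG_right (a b c : HH) : metric0 (trivG a b) c = - metric0 b (trivG a c) := by
  have h1 := metric0_coeff a (trivJ b) c
  have h2 := metric0_coeff a b (trivJ c)
  have h3 := metric0_trivJ_left (coeff a b) c
  have h4 := metric0_trivJ_left b (coeff a c)
  simp only [← trivMetric_apply, trivG_eq, map_sub, LinearMap.sub_apply] at *
  linarith

/-- The curvature operator in the left trivialization. -/
def trivCurv (a b c : HH) : HH :=
  coeff a (coeff b c) - coeff b (coeff a c) - coeff (a * b - b * a) c

/-- In terms of J = `scaledJ`/√3 the coefficients are 5/12, 1/12, 1/3, 1/3, the classical curvature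
formula of this space. Using `scaledJ` makes both sides rational polynomials in the coordinates. The
arguments must be imaginary: cross products ignore real parts, the metric does not. -/
lemma trivCurv_eq {a b c : HH} (ha : a.1.re = 0 ∧ a.2.re = 0) (hb : b.1.re = 0 ∧ b.2.re = 0)
    (hc : c.1.re = 0 ∧ c.2.re = 0) : trivCurv a b c =
    (5 / 12 : ℝ) • (metric0 b c • a - metric0 a c • b)
    + (1 / 36 : ℝ) • (metric0 (scaledJ b) c • scaledJ a - metric0 (scaledJ a) c • scaledJ b
      - (2 * metric0 (scaledJ a) b) • scaledJ c)
    + (1 / 3 : ℝ) • (metric0 (trivP b) c • trivP a - metric0 (trivP a) c • trivP b)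
    + (1 / 9 : ℝ) • (metric0 (scaledJ (trivP b)) c • scaledJ (trivP a)
      - metric0 (scaledJ (trivP a)) c • scaledJ (trivP b)) := by
  rw [trivCurv, mul_sub_mul_eq_cross]
  obtain ⟨a1, a2⟩ := ha
  obtain ⟨b1, b2⟩ := hb
  obtain ⟨c1, c2⟩ := hc
  ext1 <;> ext <;>
    simp only [metric0_coords, a1, a2, b1, b2, c1, c2, Prod.fst_add,
      Prod.snd_add, Prod.fst_sub, Prod.snd_sub, Prod.fst_neg, Prod.snd_neg,
      Prod.smul_fst, Prod.smul_snd, Quaternion.re_add, Quaternion.imI_add, Quaternion.imJ_add,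
      Quaternion.imK_add, Quaternion.re_sub, Quaternion.imI_sub, Quaternion.imJ_sub,
      Quaternion.imK_sub, Quaternion.re_neg, Quaternion.imI_neg, Quaternion.imJ_neg,
      Quaternion.imK_neg, Quaternion.re_smul, Quaternion.imI_smul, Quaternion.imJ_smul,
      Quaternion.imK_smul, smul_eq_mul, re_cross, imI_cross, imJ_cross, imK_cross, fst_coeff,
      snd_coeff, fst_scaledJ, snd_scaledJ, fst_trivP, snd_trivP] <;> ring

/-- The covariant derivative of `√3 G`. -/
lemma coeff_scaledG {x b c : HH} (hx : x.1.re = 0 ∧ x.2.re = 0) (hb : b.1.re = 0 ∧ b.2.re = 0)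
    (hc : c.1.re = 0 ∧ c.2.re = 0) :
    coeff x (scaledG b c) - scaledG (coeff x b) c - scaledG b (coeff x c) =
      (1 / 3 : ℝ) • (metric0 x c • scaledJ b - metric0 x b • scaledJ c
        - metric0 (scaledJ b) c • x) := by
  obtain ⟨a1, a2⟩ := hx
  obtain ⟨b1, b2⟩ := hb
  obtain ⟨c1, c2⟩ := hc
  ext1 <;> ext <;>
    simp only [scaledG_apply, metric0_coords, a1, a2, b1, b2, c1, c2, Prod.fst_add,
      Prod.snd_add, Prod.fst_sub, Prod.snd_sub, Prod.fst_neg, Prod.snd_neg,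
      Prod.smul_fst, Prod.smul_snd, Quaternion.re_add, Quaternion.imI_add, Quaternion.imJ_add,
      Quaternion.imK_add, Quaternion.re_sub, Quaternion.imI_sub, Quaternion.imJ_sub,
      Quaternion.imK_sub, Quaternion.re_neg, Quaternion.imI_neg, Quaternion.imJ_neg,
      Quaternion.imK_neg, Quaternion.re_smul, Quaternion.imI_smul, Quaternion.imJ_smul,
      Quaternion.imK_smul, smul_eq_mul, re_cross, imI_cross, imJ_cross, imK_cross, fst_coeff,
      snd_coeff, fst_scaledJ, snd_scaledJ, fst_trivP, snd_trivP] <;> ring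

/-! ### Directional derivatives of vector-valued functions on M, and commutators. -/

section DirectionalDerivative

variable {M : Type*} [TopologicalSpace M] [ChartedSpace (EuclideanSpace ℝ (Fin 3)) M]
variable {F G H : Type*} [NormedAddCommGroup F] [NormedSpace ℝ F] [NormedAddCommGroup G]
  [NormedSpace ℝ G] [NormedAddCommGroup H] [NormedSpace ℝ H]

/-- The directional derivative of a vector-valued function on `M`. -/
def vderiv (φ : M → F) (m : M) (v : TangentSpace (𝓡 3) m) : F :=
  mfderiv (𝓡 3) 𝓘(ℝ, F) φ m v

/-- A vector-valued function on `M` is smooth at a point. -/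
abbrev SmoothAt (φ : M → F) (m : M) : Prop := ContMDiffAt (𝓡 3) 𝓘(ℝ, F) ∞ φ m

lemma SmoothAt.mdifferentiableAt {φ : M → F} {m : M} (h : SmoothAt φ m) :
    MDifferentiableAt (𝓡 3) 𝓘(ℝ, F) φ m :=
  ContMDiffAt.mdifferentiableAt h (by simp)

lemma vderiv_add_vec (φ : M → F) (m : M) (v w : TangentSpace (𝓡 3) m) :
    vderiv φ m (v + w) = vderiv φ m v + vderiv φ m w :=
  (mfderiv (𝓡 3) 𝓘(ℝ, F) φ m).map_add v w

lemma vderiv_sub_vec (φ : M → F) (m : M) (v w : TangentSpace (𝓡 3) m) :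
    vderiv φ m (v - w) = vderiv φ m v - vderiv φ m w :=
  (mfderiv (𝓡 3) 𝓘(ℝ, F) φ m).map_sub v w

lemma vderiv_smul_vec (φ : M → F) (m : M) (r : ℝ) (v : TangentSpace (𝓡 3) m) :
    vderiv φ m (r • v) = r • vderiv φ m v :=
  (mfderiv (𝓡 3) 𝓘(ℝ, F) φ m).map_smul r v

lemma vderiv_const (c : F) (m : M) (v : TangentSpace (𝓡 3) m) :
    vderiv (fun _ => c) m v = 0 := by
  unfold vderiv
  rw [mfderiv_const]
  rfl

lemma vderiv_congr {φ ψ : M → F} {m : M} (h : φ =ᶠ[nhds m] ψ) : vderiv φ m = vderiv ψ m := by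
  funext v
  have h' : mfderiv (𝓡 3) 𝓘(ℝ, F) φ m = mfderiv (𝓡 3) 𝓘(ℝ, F) ψ m := h.mfderiv_eq
  exact congrArg (fun L => L v) h'

/-- The model has no boundary, so the derivative within its range is the ordinary one;
`TangentSpace` at m is read in the preferred chart at m. -/
lemma vderiv_eq_fderiv {φ : M → F} {m : M} (h : SmoothAt φ m) (v : TangentSpace (𝓡 3) m) :
    vderiv φ m v = fderiv ℝ (φ ∘ (extChartAt (𝓡 3) m).symm) (extChartAt (𝓡 3) m m) v := by
  have e : fderivWithin ℝ (writtenInExtChartAt (𝓡 3) 𝓘(ℝ, F) m φ) (Set.range (𝓡 3))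
      (extChartAt (𝓡 3) m m)
      = fderiv ℝ (φ ∘ (extChartAt (𝓡 3) m).symm) (extChartAt (𝓡 3) m m) := by
    rw [modelWithCornersSelf_coe, Set.range_id, fderivWithin_univ]
    rfl
  rw [← e]
  exact congrArg (fun L => L v) h.mdifferentiableAt.mfderiv

lemma SmoothAt.comp_extChartAt_symm {φ : M → F} {m : M} (h : SmoothAt φ m) :
    ContDiffAt ℝ ∞ (φ ∘ (extChartAt (𝓡 3) m).symm) (extChartAt (𝓡 3) m m) := by
  have h2 := (contMDiffAt_iff.1 h).2
  rw [modelWithCornersSelf_coe, Set.range_id, contDiffWithinAt_univ] at h2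
  exact h2

/-- A single product rule, used for the metric, the connection coefficients, G and quaternion
multiplication. Finite dimension makes an algebraic bilinear map continuous. -/
lemma vderiv_bilinear [FiniteDimensional ℝ F] [FiniteDimensional ℝ G]
    (B : F →ₗ[ℝ] G →ₗ[ℝ] H) {φ : M → F} {ψ : M → G} {m : M} (hφ : SmoothAt φ m)
    (hψ : SmoothAt ψ m) (v : TangentSpace (𝓡 3) m) :
    SmoothAt (fun m => B (φ m) (ψ m)) m ∧
    vderiv (fun m => B (φ m) (ψ m)) m v = B (vderiv φ m v) (ψ m) + B (φ m) (vderiv ψ m v) := by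
  let C : F →L[ℝ] G →L[ℝ] H :=
    (((LinearMap.toContinuousLinearMap : (G →ₗ[ℝ] H) ≃ₗ[ℝ] (G →L[ℝ] H)) : _ →ₗ[ℝ] _).comp
      B).toContinuousLinearMap
  have hC := C.isBoundedBilinearMap
  have hpair : SmoothAt (fun m => (φ m, ψ m)) m := hφ.prodMk_space hψ
  have hs : SmoothAt (fun m => B (φ m) (ψ m)) m :=
    ContDiff.comp_contMDiffAt (g := fun p : F × G => C p.1 p.2) hC.contDiff hpair
  refine ⟨hs, ?_⟩
  rw [vderiv_eq_fderiv hs, vderiv_eq_fderiv hφ, vderiv_eq_fderiv hψ]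
  have h := C.hasFDerivAt_of_bilinear
    (hφ.comp_extChartAt_symm.differentiableAt (by simp)).hasFDerivAt
    (hψ.comp_extChartAt_symm.differentiableAt (by simp)).hasFDerivAt
  have e : (fun m => B (φ m) (ψ m)) ∘ (extChartAt (𝓡 3) m).symm = fun y =>
      C ((φ ∘ (extChartAt (𝓡 3) m).symm) y) ((ψ ∘ (extChartAt (𝓡 3) m).symm) y) := rfl
  rw [e, h.fderiv]
  refine (add_comm _ _).trans ?_
  simp only [Function.comp_apply, extChartAt_to_inv]
  rfl

lemma vderiv_linear [FiniteDimensional ℝ F] (L : F →ₗ[ℝ] G) {φ : M → F} {m : M}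
    (hφ : SmoothAt φ m) (v : TangentSpace (𝓡 3) m) :
    SmoothAt (fun m => L (φ m)) m ∧ vderiv (fun m => L (φ m)) m v = L (vderiv φ m v) := by
  let C : F →L[ℝ] G := L.toContinuousLinearMap
  refine ⟨C.contDiff.comp_contMDiffAt hφ, ?_⟩
  have h2 := (C.hasFDerivAt (x := φ m)).hasMFDerivAt.comp m hφ.mdifferentiableAt.hasMFDerivAt
  exact congrArg (fun L => L v) h2.mfderiv

lemma vderiv_add {φ ψ : M → F} {m : M} (hφ : SmoothAt φ m) (hψ : SmoothAt ψ m)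
    (v : TangentSpace (𝓡 3) m) :
    vderiv (fun m => φ m + ψ m) m v = vderiv φ m v + vderiv ψ m v := by
  unfold vderiv
  exact congrArg (fun L => L v) (mfderiv_add hφ.mdifferentiableAt hψ.mdifferentiableAt)

lemma vderiv_sub {φ ψ : M → F} {m : M} (hφ : SmoothAt φ m) (hψ : SmoothAt ψ m)
    (v : TangentSpace (𝓡 3) m) :
    vderiv (fun m => φ m - ψ m) m v = vderiv φ m v - vderiv ψ m v := by
  unfold vderiv
  exact congrArg (fun L => L v) (mfderiv_sub hφ.mdifferentiableAt hψ.mdifferentiableAt)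

variable [IsManifold (𝓡 3) ∞ M]

lemma SmoothAt.vderiv_field {φ : M → F} {m : M} (hφ : SmoothAt φ m)
    {X : ∀ m : M, TangentSpace (𝓡 3) m} (hX : IsSmoothField X) :
    SmoothAt (fun m' => vderiv φ m' (X m')) m := by
  -- Work at finite order: being C^(n+1) at a point gives C^(n+1) on a neighbourhood, which may
  -- depend on n, and the tangent map then loses one derivative.
  refine contMDiffAt_infty.2 fun n => ?_
  have hφ' : ContMDiffAt (𝓡 3) 𝓘(ℝ, F) (n + 1 : ℕ) φ m := contMDiffAt_infty.1 hφ (n + 1)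
  obtain ⟨u, hu, hφu⟩ := (contMDiffAt_iff_contMDiffOn_nhds (by simp)).1 hφ'
  obtain ⟨s, hs, hso, hm⟩ := mem_nhds_iff.1 hu
  have h1 := (hφu.mono hs).contMDiffOn_tangentMapWithin (m := n) (by simp) hso.uniqueMDiffOn
  have h2 : ContMDiffOn (𝓡 3) 𝓘(ℝ, F).tangent n
      (fun m' => tangentMapWithin (𝓡 3) 𝓘(ℝ, F) φ s ⟨m', X m'⟩) s :=
    h1.comp ((ContMDiff.contMDiffOn hX).of_le (WithTop.coe_le_coe.2 le_top))
      (fun m' hm' => hm')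
  have h3 := (contMDiff_snd_tangentBundle_modelSpace F 𝓘(ℝ, F) (n := n)).comp_contMDiffOn h2
  refine (h3.contMDiffAt (hso.mem_nhds hm)).congr_of_eventuallyEq ?_
  filter_upwards [hso.mem_nhds hm] with m' hm'
  have h4 : mfderivWithin (𝓡 3) 𝓘(ℝ, F) φ s m' = mfderiv (𝓡 3) 𝓘(ℝ, F) φ m' :=
    mfderivWithin_of_isOpen hso hm'
  exact congrArg (fun L => L (X m')) h4.symm

/-- The Lie bracket as a commutator of derivations. -/
lemma exists_commutator_eq {X Y : ∀ m : M, TangentSpace (𝓡 3) m} (hX : IsSmoothField X)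
    (hY : IsSmoothField Y) (m : M) :
    ∃ b : TangentSpace (𝓡 3) m, ∀ φ : M → F, (∀ m', SmoothAt φ m') →
      vderiv (fun m' => vderiv φ m' (Y m')) m (X m) - vderiv (fun m' => vderiv φ m' (X m')) m (Y m)
        = vderiv φ m b := by
  set e := extChartAt (𝓡 3) m with he
  have hsrc : e.source ∈ nhds m := extChartAt_source_mem_nhds m
  have hes : ∀ m' ∈ e.source, SmoothAt e m' := fun m' hm' =>
    contMDiffAt_extChartAt' (by rwa [extChartAt_source] at hm')
  -- The coordinate expression of a field in the chart centred at m.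
  let lift : (∀ m : M, TangentSpace (𝓡 3) m) →
      EuclideanSpace ℝ (Fin 3) → EuclideanSpace ℝ (Fin 3) :=
    fun Z y => vderiv e (e.symm y) (Z (e.symm y))
  have lift_smooth : ∀ {Z : ∀ m : M, TangentSpace (𝓡 3) m}, IsSmoothField Z →
      ContDiffAt ℝ ∞ (lift Z) (e m) := fun hZ =>
    ((hes m (mem_extChartAt_source m)).vderiv_field hZ).comp_extChartAt_symm
  have hat_smooth : ∀ φ : M → F, (∀ m', SmoothAt φ m') → ∀ y ∈ e.target,
      ContDiffAt ℝ ∞ (φ ∘ e.symm) y := fun φ hφ y hy =>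
    ((hφ (e.symm y)).comp y ((contMDiffOn_extChartAt_symm m).contMDiffAt
      ((isOpen_extChartAt_target m).mem_nhds hy))).contDiffAt
  have local_form : ∀ φ : M → F, (∀ m', SmoothAt φ m') → ∀ m' ∈ e.source,
      ∀ v : TangentSpace (𝓡 3) m',
      vderiv φ m' v = fderiv ℝ (φ ∘ e.symm) (e m') (vderiv e m' v) := by
    intro φ hφ m' hm'
    have h1 : SmoothAt (φ ∘ e.symm ∘ e) m' := (hφ m').congr_of_eventuallyEq
      (by filter_upwards [(isOpen_extChartAt_source m).mem_nhds hm'] with z hz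
          simp only [Function.comp_apply, e.left_inv hz])
    have h2 : vderiv φ m' = vderiv (φ ∘ e.symm ∘ e) m' := by
      refine vderiv_congr ?_
      filter_upwards [(isOpen_extChartAt_source m).mem_nhds hm'] with z hz
      simp only [Function.comp_apply, e.left_inv hz]
    have h3 : DifferentiableAt ℝ (φ ∘ e.symm) (e m') :=
      (hat_smooth φ hφ (e m') (e.map_source hm')).differentiableAt (by simp)
    intro v
    rw [h2]
    exact congrArg (fun L => L v)
      (h3.hasFDerivAt.hasMFDerivAt.comp m' (hes m' hm').mdifferentiableAt.hasMFDerivAt).mfderiv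
  -- A second derivative along two fields is a Hessian term plus a first-order term; the Hessian
  -- terms cancel in the commutator by symmetry.
  have second : ∀ φ : M → F, (∀ m', SmoothAt φ m') → ∀ {Z W : ∀ m : M, TangentSpace (𝓡 3) m},
      IsSmoothField Z → IsSmoothField W →
      vderiv (fun m' => vderiv φ m' (W m')) m (Z m) =
        fderiv ℝ (fderiv ℝ (φ ∘ e.symm)) (e m) (lift Z (e m)) (lift W (e m))
          + fderiv ℝ (φ ∘ e.symm) (e m) (fderiv ℝ (lift W) (e m) (lift Z (e m))) := by
    intro φ hφ Z W hZ hW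
    have hm := mem_extChartAt_source (I := 𝓡 3) m
    have hZm : lift Z (e m) = vderiv e m (Z m) := by
      change vderiv e (e.symm (e m)) (Z (e.symm (e m))) = _
      rw [e.left_inv hm]
    have g1 : DifferentiableAt ℝ (fderiv ℝ (φ ∘ e.symm)) (e m) :=
      ((hat_smooth φ hφ (e m) (e.map_source hm)).fderiv_right (m := ∞) (by simp)).differentiableAt
        (by simp)
    have g2 := (lift_smooth hW).differentiableAt (by simp)
    have g3 := g1.hasFDerivAt.clm_apply g2.hasFDerivAt
    have h2 : vderiv (fun m' => vderiv φ m' (W m')) m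
        = vderiv ((fun y => fderiv ℝ (φ ∘ e.symm) y (lift W y)) ∘ e) m := by
      refine vderiv_congr ?_
      filter_upwards [hsrc] with z hz
      change vderiv φ z (W z)
        = fderiv ℝ (φ ∘ e.symm) (e z) (vderiv e (e.symm (e z)) (W (e.symm (e z))))
      rw [e.left_inv hz]
      exact local_form φ hφ z hz (W z)
    rw [h2]
    have h5 := congrArg (fun L => L (Z m))
      (g3.hasMFDerivAt.comp m (hes m hm).mdifferentiableAt.hasMFDerivAt).mfderiv
    refine Eq.trans h5 ?_
    rw [hZm]
    exact add_comm _ _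
  refine ⟨fderiv ℝ (lift Y) (e m) (lift X (e m)) - fderiv ℝ (lift X) (e m) (lift Y (e m)), ?_⟩
  intro φ hφ
  have symm : IsSymmSndFDerivAt ℝ (φ ∘ e.symm) (e m) :=
    (hat_smooth φ hφ (e m) (e.map_source (mem_extChartAt_source m))).isSymmSndFDerivAt
      (by simp only [minSmoothness_of_isRCLikeNormedField]; exact WithTop.coe_le_coe.2 le_top)
  rw [second φ hφ hX hY, second φ hφ hY hX, symm.eq]
  refine Eq.trans ?_ (vderiv_eq_fderiv (hφ m) _).symm
  refine Eq.trans ?_ (map_sub (fderiv ℝ (φ ∘ e.symm) (e m)) _ _).symm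
  abel

end DirectionalDerivative

/-! ### The ambient structure on left-invariant fields. -/

section

/-- The Lie algebra of `S³ × S³` consists of the pairs of imaginary quaternions. -/
def IsImag (a : HH) : Prop := a.1.re = 0 ∧ a.2.re = 0

/-- The two real parts of a pair of quaternions. -/
def realParts : HH →ₗ[ℝ] ℝ × ℝ where
  toFun a := (a.1.re, a.2.re)
  map_add' _ _ := rfl
  map_smul' _ _ := by simp

lemma isImag_iff {a : HH} : IsImag a ↔ realParts a = 0 :=
  ⟨fun h => Prod.ext h.1 h.2, fun h => ⟨congrArg Prod.fst h, congrArg Prod.snd h⟩⟩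

lemma IsImag.add {a b : HH} (ha : IsImag a) (hb : IsImag b) : IsImag (a + b) := by
  rw [isImag_iff] at *
  rw [map_add, ha, hb, add_zero]

lemma IsImag.sub {a b : HH} (ha : IsImag a) (hb : IsImag b) : IsImag (a - b) := by
  rw [isImag_iff] at *
  rw [map_sub, ha, hb, sub_zero]

lemma IsImag.coeff (a b : HH) : IsImag (coeff a b) := coeff_re a b

lemma IsImag.scaledJ {a : HH} (ha : IsImag a) : IsImag (scaledJ a) := by
  simp [IsImag, fst_scaledJ, snd_scaledJ, ha.1, ha.2]

lemma IsImag.trivJ {a : HH} (ha : IsImag a) : IsImag (trivJ a) := by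
  have h := isImag_iff.1 ha.scaledJ
  rw [isImag_iff, trivJ_apply, map_smul, h, smul_zero]

lemma nkJ_leftMul_eq {x : HH} (hx : x ∈ S3xS3) (a : HH) :
    nkJ x (leftMul x a) = leftMul x (trivJ a) := by
  rw [nkJ_leftMul hx, trivJ_apply]
  congr 1
  ext1
  · rfl
  · simp only [Prod.smul_snd, snd_scaledJ]
    congr 1
    abel

lemma nkP_leftMul {x : HH} (hx : x ∈ S3xS3) (a : HH) :
    nkP x (leftMul x a) = leftMul x (trivP a) := by
  obtain ⟨h1, h2⟩ := ne_zero_of_mem hx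
  ext1 <;> simp [nkP, leftMul, fst_trivP, snd_trivP, mul_assoc, h1, h2]

/-- Joint smoothness is needed because base point and vector both vary along M. -/
lemma contDiffAt_uncurry_leftTriv {x : HH} (hx : x ∈ S3xS3) (U : HH) :
    ContDiffAt ℝ ∞ (fun p : HH × HH => leftTriv p.1 p.2) (x, U) := by
  obtain ⟨h1, h2⟩ := ne_zero_of_mem hx
  have k : ∀ {p : ℍ}, p ≠ 0 → ContDiffAt ℝ ∞ (fun z : ℍ => z⁻¹) p := by
    intro p hp
    have := contDiffAt_ringInverse ℝ (n := ∞) (Units.mk0 p hp)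
    rwa [Ring.inverse_eq_inv'] at this
  have e1 : ContDiffAt ℝ ∞ (fun y : HH × HH => y.1.1⁻¹) (x, U) :=
    ContDiffAt.comp (f := fun y : HH × HH => y.1.1) (g := fun z : ℍ => z⁻¹) (x, U) (k h1)
      (by fun_prop)
  have e2 : ContDiffAt ℝ ∞ (fun y : HH × HH => y.1.2⁻¹) (x, U) :=
    ContDiffAt.comp (f := fun y : HH × HH => y.1.2) (g := fun z : ℍ => z⁻¹) (x, U) (k h2)
      (by fun_prop)
  exact (e1.mul (contDiffAt_snd.fst)).prodMk (e2.mul (contDiffAt_snd.snd))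

/-- A left-invariant field is constant in the left trivialization, so only the coefficient term
remains. -/
lemma leviCivita_leftInv {x a b : HH} (hx : x ∈ S3xS3) (ha : IsImag a) (hb : IsImag b) :
    leviCivita (leftInv a) (leftInv b) x = leftMul x (coeff a b) := by
  have ha' := leftInv_isVectorField ha.1 ha.2
  have hb' := leftInv_isVectorField hb.1 hb.2
  rw [leviCivita_eq_connFormula ha' hb' hx]
  have hz := fderiv_congr (φ := fun y => leftTriv y (leftInv b y)) (ψ := fun _ => b) hx
    (ha'.tangent _ hx) (hb'.differentiableAt_leftTriv hx) (differentiableAt_const _)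
    (fun y hy => leftTriv_leftMul hy b)
  simp only [connFormula]
  rw [hz]
  simp [leftInv, leftTriv_leftMul hx]

/-- J commutes with left translations, so along S³ × S³ it takes left-invariant fields to
left-invariant fields and no derivative term appears. -/
lemma nkG_leftMul {x a b : HH} (hx : x ∈ S3xS3) (ha : IsImag a) (hb : IsImag b) :
    nkG x (leftMul x a) (leftMul x b) = leftMul x (trivG a b) := by
  have ha' := leftInv_isVectorField ha.1 ha.2
  have hJ : IsVectorField (fun y => nkJ y (leftInv b y)) := by
    refine ⟨fun y hy => ?_, fun y hy => ?_⟩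
    · have hb' := leftInv_isVectorField hb.1 hb.2
      have h1 := contDiffAt_leftTriv hy (hb'.smooth y hy)
      have h2 := hb'.smooth y hy
      have h3 : ContDiffAt ℝ ∞ (fun y => (leftTriv y (leftInv b y)).1) y := h1.fst
      have h4 : ContDiffAt ℝ ∞ (fun y => (leftTriv y (leftInv b y)).2) y := h1.snd
      have e : (fun y => nkJ y (leftInv b y)) = fun y =>
          ((1 / Real.sqrt 3) • ((2 : ℝ) • (y.1 * (leftTriv y (leftInv b y)).2) - (leftInv b y).1),
            (1 / Real.sqrt 3) •
              (-((2 : ℝ) • (y.2 * (leftTriv y (leftInv b y)).1)) + (leftInv b y).2)) := by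
        funext y; simp only [nkJ, leftTriv, mul_assoc]
      rw [e]
      fun_prop
    · rw [leftInv, nkJ_leftMul_eq hy]
      exact (isTangent_leftMul_iff hy _).2 hb.trivJ
  rw [nkG, leftTriv_leftMul hx, leftTriv_leftMul hx, leviCivita_leftInv hx ha hb,
    nkJ_leftMul_eq hx, leviCivita_eq_connFormula ha' hJ hx, connFormula]
  have hz := fderiv_congr (φ := fun y => leftTriv y (nkJ y (leftInv b y)))
    (ψ := fun _ => trivJ b) hx (ha'.tangent _ hx) (hJ.differentiableAt_leftTriv hx)
    (differentiableAt_const _)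
    (fun y hy => by simp only [leftInv, nkJ_leftMul_eq hy, leftTriv_leftMul hy])
  rw [hz]
  simp only [leftInv, nkJ_leftMul_eq hx, leftTriv_leftMul hx, trivG_eq]
  ext1 <;> simp [leftMul, mul_sub]

/-! ### Lagrangian immersions in the left trivialization. -/

variable {M : Type*} [TopologicalSpace M] [ChartedSpace (EuclideanSpace ℝ (Fin 3)) M]

lemma IsImag.vderiv {φ : M → HH} {m : M} (hφ : SmoothAt φ m) (h : ∀ m', IsImag (φ m'))
    (v : TangentSpace (𝓡 3) m) : IsImag (vderiv φ m v) := by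
  rw [isImag_iff, ← (vderiv_linear realParts hφ v).2]
  have e : (fun m => realParts (φ m)) = fun _ => 0 := funext fun m => isImag_iff.1 (h m)
  rw [e, vderiv_const]

lemma IsLagrangianImmersion.smoothAt_emb {f : M → S3 × S3}
    (hf : IsLagrangianImmersion f) (m : M) : SmoothAt (emb f) m := by
  have h1 : ContMDiff (𝓡 3) 𝓘(ℝ, ℍ) ∞ (fun m => ((f m).1 : ℍ)) :=
    contMDiff_coe_sphere.comp (contMDiff_fst.comp hf.smooth)
  have h2 : ContMDiff (𝓡 3) 𝓘(ℝ, ℍ) ∞ (fun m => ((f m).2 : ℍ)) :=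
    contMDiff_coe_sphere.comp (contMDiff_snd.comp hf.smooth)
  exact (h1.prodMk_space h2) m

lemma IsLagrangianImmersion.smoothAt_leftTriv {f : M → S3 × S3}
    (hf : IsLagrangianImmersion f) {V : M → HH} {m : M} (hV : SmoothAt V m) :
    SmoothAt (fun m => leftTriv (emb f m) (V m)) m :=
  (contDiffAt_uncurry_leftTriv (emb_mem f m) (V m)).comp_contMDiffAt (x := m)
    ((hf.smoothAt_emb m).prodMk_space hV)

/-- Differentiate |p|² = 1 and |q|² = 1 along M. -/
lemma IsLagrangianImmersion.isTangent_dmap {f : M → S3 × S3}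
    (hf : IsLagrangianImmersion f) (m : M) (v : TangentSpace (𝓡 3) m) :
    IsTangent (emb f m) (dmap f m v) := by
  have key : ∀ L : HH →ₗ[ℝ] ℍ, (∀ m, ‖L (emb f m)‖ = 1) →
      inner ℝ (L (emb f m)) (L (dmap f m v)) = 0 := by
    intro L hL
    obtain ⟨h1, h2⟩ := vderiv_linear L (hf.smoothAt_emb m) v
    have h3 := (vderiv_bilinear (innerₗ ℍ) h1 h1 v).2
    have e : (fun m => innerₗ ℍ (L (emb f m)) (L (emb f m))) = fun _ => 1 := by
      funext m
      simp [hL m]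
    rw [e, vderiv_const, h2] at h3
    simp only [innerₗ_apply_apply, real_inner_comm] at h3
    have h4 : inner ℝ (L (emb f m)) (L (vderiv (emb f) m v)) = 0 := by
      rw [real_inner_comm]; linarith [real_inner_comm (L (emb f m)) (L (vderiv (emb f) m v))]
    exact h4
  exact ⟨key (LinearMap.fst ℝ ℍ ℍ) fun m => (emb_mem f m).1,
    key (LinearMap.snd ℝ ℍ ℍ) fun m => (emb_mem f m).2⟩

/-- The differential of `f` in the left trivialization. -/
def lieMap (f : M → S3 × S3) (m : M) : TangentSpace (𝓡 3) m →ₗ[ℝ] HH where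
  toFun v := leftTriv (emb f m) (dmap f m v)
  map_add' v w := by
    rw [← leftTriv_add]
    exact congrArg _ (vderiv_add_vec (emb f) m v w)
  map_smul' r v := by
    rw [RingHom.id_apply, ← leftTriv_smul]
    exact congrArg _ (vderiv_smul_vec (emb f) m r v)

lemma leftMul_lieMap (f : M → S3 × S3) (m : M) (v : TangentSpace (𝓡 3) m) :
    leftMul (emb f m) (lieMap f m v) = dmap f m v :=
  leftMul_leftTriv (emb_mem f m) _

lemma IsLagrangianImmersion.isImag_lieMap {f : M → S3 × S3} (hf : IsLagrangianImmersion f) (m : M)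
    (v : TangentSpace (𝓡 3) m) : IsImag (lieMap f m v) :=
  re_leftTriv (emb_mem f m) (hf.isTangent_dmap m v)

lemma IsLagrangianImmersion.injective_lieMap {f : M → S3 × S3} (hf : IsLagrangianImmersion f)
    (m : M) : Function.Injective (lieMap f m) := by
  intro v w h
  apply hf.immersion m
  rw [← leftMul_lieMap, ← leftMul_lieMap, h]

lemma IsLagrangianImmersion.metric0_trivJ_lieMap {f : M → S3 × S3} (hf : IsLagrangianImmersion f)
    (m : M) (v w : TangentSpace (𝓡 3) m) : metric0 (trivJ (lieMap f m v)) (lieMap f m w) = 0 := by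
  have h := ((hf.lagrangian m _).1 ⟨v, rfl⟩).2 w
  rwa [← leftMul_lieMap, ← leftMul_lieMap, nkJ_leftMul_eq (emb_mem f m),
    nkMetric_leftMul (emb_mem f m)] at h

/-- This is the "onto" half of the Lagrangian condition. -/
lemma IsLagrangianImmersion.exists_trivJ_eq {f : M → S3 × S3} (hf : IsLagrangianImmersion f)
    {m : M} {a : HH} (ha : IsImag a) (h : ∀ w, metric0 a (lieMap f m w) = 0) :
    ∃ u, a = trivJ (lieMap f m u) := by
  obtain ⟨u, hu⟩ := (hf.lagrangian m (leftMul (emb f m) a)).2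
    ⟨(isTangent_leftMul_iff (emb_mem f m) a).2 ha, fun w => by
      rw [← leftMul_lieMap, nkMetric_leftMul (emb_mem f m), h]⟩
  refine ⟨u, ?_⟩
  rw [← leftMul_lieMap, nkJ_leftMul_eq (emb_mem f m)] at hu
  rw [← leftTriv_leftMul (emb_mem f m) a, hu, leftTriv_leftMul (emb_mem f m)]

lemma IsLagrangianImmersion.tanPart_eq {f : M → S3 × S3} (hf : IsLagrangianImmersion f) {m : M}
    {a : HH} {u : TangentSpace (𝓡 3) m}
    (hu : ∀ w, metric0 (a - lieMap f m u) (lieMap f m w) = 0) :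
    tanPart f m (leftMul (emb f m) a) = u := by
  have hx := emb_mem f m
  have tr : ∀ u w, nkMetric (emb f m) (leftMul (emb f m) a - dmap f m u) (dmap f m w) =
      metric0 (a - lieMap f m u) (lieMap f m w) := by
    intro u w
    rw [← nkMetric_leftMul hx, leftMul_lieMap, ← leftMul_lieMap f m u]
    congr 1
    ext1 <;> simp [leftMul, mul_sub]
  have ex : ∃ u : TangentSpace (𝓡 3) m, ∀ w : TangentSpace (𝓡 3) m,
      nkMetric (emb f m) (leftMul (emb f m) a - dmap f m u) (dmap f m w) = 0 :=
    ⟨u, fun w => (tr u w).trans (hu w)⟩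
  unfold tanPart
  rw [dif_pos ex]
  have hc := fun w => (tr _ w).symm.trans (Classical.choose_spec ex w)
  set t := Classical.choose ex
  apply hf.injective_lieMap m
  -- Both candidates leave a normal remainder, so the image of t − u is orthogonal to itself;
  -- definiteness and injectivity give t = u.
  have h1 := hu (t - u)
  have h2 := hc (t - u)
  refine sub_eq_zero.1 (metric0_self_pos ?_)
  simp only [← trivMetric_apply, map_sub, LinearMap.sub_apply] at h1 h2 ⊢
  linarith

/-! ### Smoothness of the tangential projection. -/

variable [IsManifold (𝓡 3) ∞ M]

lemma IsLagrangianImmersion.smoothAt_lieMap {f : M → S3 × S3} (hf : IsLagrangianImmersion f)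
    {X : ∀ m : M, TangentSpace (𝓡 3) m} (hX : IsSmoothField X) (m : M) :
    SmoothAt (fun m => lieMap f m (X m)) m :=
  hf.smoothAt_leftTriv ((hf.smoothAt_emb m).vderiv_field hX)

/-- A smooth map to the Lie algebra has, locally, a tangential part with smooth coefficients
with respect to smooth vector fields. -/
lemma IsLagrangianImmersion.exists_local_tanPart [T2Space M] {f : M → S3 × S3}
    (hf : IsLagrangianImmersion f) {φ : M → HH} (m : M) (hφ : SmoothAt φ m) :
    ∃ X : Fin 3 → ∀ m : M, TangentSpace (𝓡 3) m, (∀ i, IsSmoothField (X i)) ∧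
      ∃ c : Fin 3 → M → ℝ, (∀ i, SmoothAt (c i) m) ∧ ∀ᶠ m' in nhds m, ∀ w,
        metric0 (φ m' - lieMap f m' (∑ i, c i m' • X i m')) (lieMap f m' w) = 0 := by
  -- Global fields extending the standard basis at m. They form a frame near m, and the coefficients
  -- of the tangential part solve the linear system given by their Gram matrix.
  choose X hX hXm using fun i : Fin 3 =>
    exists_isSmoothField m (EuclideanSpace.single i (1 : ℝ) : TangentSpace (𝓡 3) m)
  let S : ∀ m' : M, EuclideanSpace ℝ (Fin 3) →ₗ[ℝ] TangentSpace (𝓡 3) m' := fun m' =>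
    { toFun := fun c => ∑ i, c i • X i m'
      map_add' := fun c d => by
        simp only [PiLp.add_apply, add_smul, Finset.sum_add_distrib]
      map_smul' := fun r c => by
        simp only [PiLp.smul_apply, smul_eq_mul, mul_smul, Finset.smul_sum, RingHom.id_apply] }
  have lie_sum : ∀ m' c, lieMap f m' (S m' c) = ∑ i, c i • lieMap f m' (X i m') := by
    intro m' c
    change lieMap f m' (∑ i, c i • X i m') = _
    rw [map_sum]
    simp only [map_smul]
  let unit : Fin 3 → Fin 3 → EuclideanSpace ℝ (Fin 3) →L[ℝ] EuclideanSpace ℝ (Fin 3) := fun i j =>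
    (EuclideanSpace.proj i : EuclideanSpace ℝ (Fin 3) →L[ℝ] ℝ).smulRight
      (EuclideanSpace.single j (1 : ℝ))
  let gram : M → EuclideanSpace ℝ (Fin 3) →L[ℝ] EuclideanSpace ℝ (Fin 3) := fun m' =>
    ∑ i, ∑ j, metric0 (lieMap f m' (X i m')) (lieMap f m' (X j m')) • unit i j
  have gram_apply : ∀ m' c j, gram m' c j =
      metric0 (lieMap f m' (S m' c)) (lieMap f m' (X j m')) := by
    intro m' c j
    rw [lie_sum, ← trivMetric_apply, map_sum]
    simp only [gram, unit, sum_apply, smul_apply, ContinuousLinearMap.smulRight_apply,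
      WithLp.ofLp_sum, Finset.sum_apply, PiLp.smul_apply, PiLp.proj_apply, smul_eq_mul,
      PiLp.single_apply, LinearMap.sum_apply, map_smul, LinearMap.smul_apply, trivMetric_apply]
    refine Finset.sum_congr rfl fun i _ => ?_
    simp [mul_comm]
  have gram_smooth : SmoothAt gram m := by
    refine contMDiffAt_finsetSum fun i _ => contMDiffAt_finsetSum fun j _ => ?_
    exact ContMDiffAt.smul (vderiv_bilinear trivMetric (hf.smoothAt_lieMap (hX i) m)
      (hf.smoothAt_lieMap (hX j) m) 0).1 contMDiffAt_const
  -- A kernel vector of the Gram matrix gives a tangent vector orthogonal to itself; invertibility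
  -- then persists near m because units are open.
  have gram_unit : IsUnit (gram m) := by
    rw [ContinuousLinearMap.isUnit_iff_bijective]
    have hinj : Function.Injective (gram m).toLinearMap := by
      rw [← LinearMap.ker_eq_bot, LinearMap.ker_eq_bot']
      intro c hc
      have h0 : ∀ j, metric0 (lieMap f m (S m c)) (lieMap f m (X j m)) = 0 := by
        intro j
        rw [← gram_apply]
        exact congrArg (fun v : EuclideanSpace ℝ (Fin 3) => v j) hc
      have h5 : metric0 (lieMap f m (S m c)) (lieMap f m (S m c)) = 0 := by
        nth_rw 2 [lie_sum]
        rw [← trivMetric_apply, map_sum]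
        refine Finset.sum_eq_zero fun j _ => ?_
        rw [map_smul, trivMetric_apply, h0, smul_zero]
      have h6 : S m c = 0 := hf.injective_lieMap m ((metric0_self_pos h5).trans (map_zero _).symm)
      have h7 : ∑ i, c i • EuclideanSpace.single i (1 : ℝ) = 0 := by
        change ∑ i, c i • X i m = 0 at h6
        simp only [hXm] at h6
        exact h6
      ext j
      have h8 := congrArg (fun v : EuclideanSpace ℝ (Fin 3) => v j) h7
      simpa [Pi.single_apply] using h8
    exact ⟨hinj, LinearMap.injective_iff_surjective.1 hinj⟩
  let rhs : M → EuclideanSpace ℝ (Fin 3) := fun m' =>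
    ∑ j, metric0 (φ m') (lieMap f m' (X j m')) • EuclideanSpace.single j (1 : ℝ)
  have rhs_smooth : SmoothAt rhs m := by
    refine contMDiffAt_finsetSum fun j _ => ?_
    exact ContMDiffAt.smul (vderiv_bilinear trivMetric hφ
      (hf.smoothAt_lieMap (hX j) m) 0).1 contMDiffAt_const
  have inv_smooth : SmoothAt (fun m' => Ring.inverse (gram m')) m := by
    obtain ⟨u, hu⟩ := gram_unit
    have := contDiffAt_ringInverse ℝ (n := ∞) u
    rw [hu] at this
    exact this.comp_contMDiffAt gram_smooth
  refine ⟨X, hX, fun i m' => Ring.inverse (gram m') (rhs m') i, fun i => ?_, ?_⟩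
  · exact (EuclideanSpace.proj i : EuclideanSpace ℝ (Fin 3) →L[ℝ] ℝ).contDiff.comp_contMDiffAt
      (inv_smooth.clm_apply rhs_smooth)
  · have hopen : ∀ᶠ m' in nhds m, IsUnit (gram m') :=
      gram_smooth.continuousAt.eventually (Units.isOpen.mem_nhds gram_unit)
    filter_upwards [hopen] with m' hm' w
    have hsol : gram m' (Ring.inverse (gram m') (rhs m')) = rhs m' :=
      congrArg (fun L => L (rhs m')) (Ring.mul_inverse_cancel _ hm')
    -- Invertibility of the Gram matrix makes the fields independent at m', and a dimension count
    -- makes them span.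
    have hinj : Function.Injective (S m') := by
      rw [← LinearMap.ker_eq_bot, LinearMap.ker_eq_bot']
      intro c hc
      have : gram m' c = 0 := by
        ext j
        rw [gram_apply, hc]
        simp [metric0]
      have h1 : Ring.inverse (gram m') (gram m' c) = c :=
        congrArg (fun L => L c) (Ring.inverse_mul_cancel _ hm')
      rw [← h1, this, map_zero]
    have hsurj : Function.Surjective (S m') := by
      have : FiniteDimensional ℝ (TangentSpace (𝓡 3) m') :=
        inferInstanceAs (FiniteDimensional ℝ (EuclideanSpace ℝ (Fin 3)))
      exact (LinearMap.injective_iff_surjective_of_finrank_eq_finrank rfl).1 hinj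
    obtain ⟨d, rfl⟩ := hsurj w
    have h1 : ∀ j, metric0 (φ m' - lieMap f m' (S m' (Ring.inverse (gram m') (rhs m'))))
        (lieMap f m' (X j m')) = 0 := by
      intro j
      have h2 := gram_apply m' (Ring.inverse (gram m') (rhs m')) j
      rw [hsol] at h2
      have h3 : rhs m' j = metric0 (φ m') (lieMap f m' (X j m')) := by
        simp [rhs, Pi.single_apply]
      rw [← trivMetric_apply, map_sub, LinearMap.sub_apply, trivMetric_apply, trivMetric_apply,
        ← h2, h3, sub_self]
    change metric0 (φ m' - lieMap f m' (S m' (Ring.inverse (gram m') (rhs m'))))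
      (lieMap f m' (S m' d)) = 0
    rw [lie_sum m' d, ← trivMetric_apply]
    refine (map_sum _ _ _).trans (Finset.sum_eq_zero fun j _ => ?_)
    rw [map_smul, trivMetric_apply, h1, smul_zero]

lemma IsLagrangianImmersion.isSmoothField_tanPart [T2Space M] {f : M → S3 × S3}
    (hf : IsLagrangianImmersion f) {φ : M → HH} (hφ : ∀ m, SmoothAt φ m) :
    IsSmoothField (fun m => tanPart f m (leftMul (emb f m) (φ m))) := by
  intro m
  obtain ⟨X, hX, c, hc, h⟩ := hf.exists_local_tanPart m (hφ m)
  have h1 : ContMDiffAt (𝓡 3) (𝓡 3).tangent ∞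
      (fun m => (⟨m, ∑ i, c i m • X i m⟩ : TangentBundle (𝓡 3) M)) m :=
    .sum_section fun i _ => (hc i).smul_section (hX i m)
  refine h1.congr_of_eventuallyEq ?_
  filter_upwards [h] with m' hm'
  rw [hf.tanPart_eq hm']

/-- Existence of the orthogonal decomposition follows from the local construction applied to the
constant map a. -/
lemma IsLagrangianImmersion.metric0_sub_tanPart [T2Space M] {f : M → S3 × S3}
    (hf : IsLagrangianImmersion f) (m : M) (a : HH) (w : TangentSpace (𝓡 3) m) :
    metric0 (a - lieMap f m (tanPart f m (leftMul (emb f m) a))) (lieMap f m w) = 0 := by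
  obtain ⟨X, hX, c, hc, h⟩ := hf.exists_local_tanPart m (φ := fun _ => a) contMDiffAt_const
  have h := h.self_of_nhds
  rw [hf.tanPart_eq h]
  exact h w

end

/-! ### Pull-back connection, second fundamental form and its cubic form. -/

section

lemma leftMul_sub (x a b : HH) : leftMul x (a - b) = leftMul x a - leftMul x b := by
  ext1 <;> simp [leftMul, mul_sub]

variable {M : Type*} [TopologicalSpace M] [ChartedSpace (EuclideanSpace ℝ (Fin 3)) M]

/-- A vector field on `M` in the left trivialization. -/
abbrev lieField (f : M → S3 × S3) (X : ∀ m : M, TangentSpace (𝓡 3) m) (m : M) : HH :=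
  lieMap f m (X m)

/-- The pull-back connection in the left trivialization. -/
def cov (f : M → S3 × S3) (X : ∀ m : M, TangentSpace (𝓡 3) m) (φ : M → HH) (m : M) : HH :=
  vderiv φ m (X m) + coeff (lieMap f m (X m)) (φ m)

/-- The second fundamental form in the left trivialization. -/
def lieSFF (f : M → S3 × S3) (X Y : ∀ m : M, TangentSpace (𝓡 3) m) (m : M) : HH :=
  cov f X (lieField f Y) m - lieMap f m (indConn f X Y m)

/-- The cubic form `g(h(X, Y), J Z)`. -/
def cubicForm (f : M → S3 × S3) (X Y Z : ∀ m : M, TangentSpace (𝓡 3) m) (m : M) : ℝ :=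
  metric0 (lieSFF f X Y m) (trivJ (lieMap f m (Z m)))

section Pointwise

variable {f : M → S3 × S3}

lemma IsLagrangianImmersion.pullConn_leftMul (hf : IsLagrangianImmersion f)
    (X : ∀ m : M, TangentSpace (𝓡 3) m) {φ : M → HH} {m : M} (hφ : IsImag (φ m)) :
    pullConn f m (X m) (fun m' => leftMul (emb f m') (φ m')) = leftMul (emb f m) (cov f X φ m) := by
  have e : (fun m' => leftTriv (emb f m') (leftMul (emb f m') (φ m'))) = φ :=
    funext fun m' => leftTriv_leftMul (emb_mem f m') _
  unfold pullConn
  rw [e, leftTriv_leftMul (emb_mem f m), cov, leftMul_add]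
  exact congrArg _ (leviCivita_leftInv (emb_mem f m) (hf.isImag_lieMap m (X m)) hφ)

lemma IsLagrangianImmersion.metric0_lieMap_trivJ (hf : IsLagrangianImmersion f) (m : M)
    (v w : TangentSpace (𝓡 3) m) : metric0 (lieMap f m v) (trivJ (lieMap f m w)) = 0 := by
  rw [metric0_comm]
  exact hf.metric0_trivJ_lieMap m w v

lemma IsLagrangianImmersion.pullConn_dmap (hf : IsLagrangianImmersion f)
    (X Y : ∀ m : M, TangentSpace (𝓡 3) m) (m : M) :
    pullConn f m (X m) (fun m' => dmap f m' (Y m'))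
      = leftMul (emb f m) (cov f X (lieField f Y) m) := by
  rw [← hf.pullConn_leftMul X (hf.isImag_lieMap m (Y m))]
  congr 1
  exact funext fun m' => (leftMul_lieMap f m' _).symm

lemma IsLagrangianImmersion.indConn_eq (hf : IsLagrangianImmersion f)
    (X Y : ∀ m : M, TangentSpace (𝓡 3) m) :
    indConn f X Y
      = fun m => tanPart f m (leftMul (emb f m) (cov f X (lieField f Y) m)) := by
  funext m
  rw [indConn, hf.pullConn_dmap]

lemma norPart_leftMul (m : M) (a : HH) :
    norPart f m (leftMul (emb f m) a)
      = leftMul (emb f m) (a - lieMap f m (tanPart f m (leftMul (emb f m) a))) := by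
  rw [norPart, leftMul_sub, leftMul_lieMap]

lemma IsLagrangianImmersion.secondFF_eq (hf : IsLagrangianImmersion f)
    (X Y : ∀ m : M, TangentSpace (𝓡 3) m) :
    secondFF f X Y = fun m => leftMul (emb f m) (lieSFF f X Y m) := by
  funext m
  rw [secondFF, hf.pullConn_dmap, norPart_leftMul, lieSFF, indConn, hf.pullConn_dmap]

end Pointwise

section

variable {f : M → S3 × S3} {X Y : ∀ m : M, TangentSpace (𝓡 3) m}

lemma IsImag.cov {φ : M → HH} {m : M} (hφ : SmoothAt φ m) (h : ∀ m', IsImag (φ m')) :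
    IsImag (cov f X φ m) :=
  (IsImag.vderiv hφ h _).add (IsImag.coeff _ _)

/-- Metric compatibility: the coefficient terms cancel by `metric0_coeff`. -/
lemma vderiv_metric0 {φ ψ : M → HH} {m : M} (hφ : SmoothAt φ m) (hψ : SmoothAt ψ m)  :
    vderiv (fun m => metric0 (φ m) (ψ m)) m (X m)
      = metric0 (cov f X φ m) (ψ m) + metric0 (φ m) (cov f X ψ m) := by
  refine (vderiv_bilinear trivMetric hφ hψ (X m)).2.trans ?_
  have h := metric0_coeff (lieMap f m (X m)) (φ m) (ψ m)
  simp only [cov, trivMetric_apply, metric0_add_left, metric0_add_right]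
  linarith

lemma cov_trivJ {φ : M → HH} {m : M} (hφ : SmoothAt φ m) :
    cov f X (fun m => trivJ (φ m)) m
      = trivJ (cov f X φ m) + trivG (lieMap f m (X m)) (φ m) := by
  rw [cov, (vderiv_linear trivJ hφ (X m)).2, trivG_eq, cov, map_add]
  abel

lemma cov_sub {φ ψ : M → HH} {m : M} (hφ : SmoothAt φ m) (hψ : SmoothAt ψ m) :
    cov f X (fun m => φ m - ψ m) m = cov f X φ m - cov f X ψ m := by
  rw [cov, vderiv_sub hφ hψ, cov, cov]
  simp only [← trivCoeff_apply, map_sub]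
  abel

lemma cov_eq_add (f : M → S3 × S3) (X Y : ∀ m : M, TangentSpace (𝓡 3) m) (m : M) :
    cov f X (lieField f Y) m = lieMap f m (indConn f X Y m) + lieSFF f X Y m := by
  rw [lieSFF]; abel

lemma IsLagrangianImmersion.metric0_cov_trivJ (hf : IsLagrangianImmersion f) (m : M)
    (w : TangentSpace (𝓡 3) m) : metric0 (cov f X (lieField f Y) m) (trivJ (lieMap f m w))
      = metric0 (lieSFF f X Y m) (trivJ (lieMap f m w)) := by
  rw [cov_eq_add, metric0_add_left, hf.metric0_lieMap_trivJ, zero_add]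

end

variable [IsManifold (𝓡 3) ∞ M] {f : M → S3 × S3} {X Y Z W : ∀ m : M, TangentSpace (𝓡 3) m}

lemma IsLagrangianImmersion.smoothAt_cov (hf : IsLagrangianImmersion f) (hX : IsSmoothField X)
    {φ : M → HH} (hφ : ∀ m, SmoothAt φ m) (m : M) : SmoothAt (cov f X φ) m :=
  ((hφ m).vderiv_field hX).add
    (vderiv_bilinear trivCoeff (hf.smoothAt_lieMap hX m) (hφ m) 0).1

/-- The curvature identity and the absence of torsion for the pull-back connection. -/
lemma IsLagrangianImmersion.exists_bracket (hf : IsLagrangianImmersion f) (hX : IsSmoothField X)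
    (hY : IsSmoothField Y) (m : M) : ∃ b : TangentSpace (𝓡 3) m,
      cov f X (lieField f Y) m - cov f Y (lieField f X) m = lieMap f m b ∧
      ∀ φ : M → HH, (∀ m, SmoothAt φ m) → cov f X (cov f Y φ) m - cov f Y (cov f X φ) m
        = trivCurv (lieMap f m (X m)) (lieMap f m (Y m)) (φ m)
          + (vderiv φ m b + coeff (lieMap f m b) (φ m)) := by
  -- The same bracket vector serves φ and the embedding, since both take values in `HH`.
  obtain ⟨b, hb⟩ := exists_commutator_eq (F := HH) hX hY m
  have hx := emb_mem f m
  have second : ∀ {X Y : ∀ m : M, TangentSpace (𝓡 3) m}, IsSmoothField X → IsSmoothField Y →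
      vderiv (fun m' => vderiv (emb f) m' (Y m')) m (X m) = leftMul (emb f m)
        (lieMap f m (X m) * lieMap f m (Y m) + vderiv (lieField f Y) m (X m)) := by
    intro X Y hX hY
    have e : (fun m' => vderiv (emb f) m' (Y m'))
        = fun m' => LinearMap.mul ℝ HH (emb f m') (lieField f Y m') :=
      funext fun m' => (leftMul_lieMap f m' (Y m')).symm
    rw [e, (vderiv_bilinear _ (hf.smoothAt_emb m) (hf.smoothAt_lieMap hY m) (X m)).2,
      leftMul_add]
    congr 1
    change dmap f m (X m) * _ = emb f m * (_ * _)
    rw [← mul_assoc]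
    exact congrArg (· * _) (leftMul_lieMap f m (X m)).symm
  -- The Maurer–Cartan equation, obtained by applying the commutator formula to the embedding
  -- itself.
  have hbr : vderiv (lieField f Y) m (X m) - vderiv (lieField f X) m (Y m) = lieMap f m b
      - (lieMap f m (X m) * lieMap f m (Y m) - lieMap f m (Y m) * lieMap f m (X m)) := by
    have h := hb (emb f) hf.smoothAt_emb
    rw [second hX hY, second hY hX, ← leftMul_sub] at h
    have h2 : vderiv (emb f) m b = leftMul (emb f m) (lieMap f m b) := (leftMul_lieMap f m b).symm
    rw [h2] at h
    have h3 := congrArg (leftTriv (emb f m)) h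
    rw [leftTriv_leftMul hx, leftTriv_leftMul hx] at h3
    rw [← h3]
    abel
  refine ⟨b, ?_, fun φ hφ => ?_⟩
  · have h := coeff_sub (lieMap f m (X m)) (lieMap f m (Y m))
    rw [cov, cov, add_sub_add_comm, hbr, h]
    abel
  · have expand : ∀ {X Y : ∀ m : M, TangentSpace (𝓡 3) m}, IsSmoothField X → IsSmoothField Y →
        cov f X (cov f Y φ) m = vderiv (fun m' => vderiv φ m' (Y m')) m (X m)
          + (coeff (vderiv (lieField f Y) m (X m)) (φ m)
            + coeff (lieMap f m (Y m)) (vderiv φ m (X m)))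
          + (coeff (lieMap f m (X m)) (vderiv φ m (Y m))
            + coeff (lieMap f m (X m)) (coeff (lieMap f m (Y m)) (φ m))) := by
      intro X Y hX hY
      have h1 := vderiv_bilinear trivCoeff (hf.smoothAt_lieMap hY m) (hφ m) (X m)
      have h2 := vderiv_add ((hφ m).vderiv_field hY) h1.1 (X m)
      rw [h1.2] at h2
      rw [← coeff_add_right]
      exact congrArg (· + _) h2
    rw [expand hX hY, expand hY hX, trivCurv, ← hb φ hφ]
    have h := congrArg (fun a => coeff a (φ m)) hbr
    simp only [← trivCoeff_apply, map_sub, LinearMap.sub_apply] at h ⊢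
    rw [sub_eq_iff_eq_add] at h
    rw [h]
    abel

lemma IsLagrangianImmersion.isImag_lieSFF (hf : IsLagrangianImmersion f)
    (hY : IsSmoothField Y) (m : M) : IsImag (lieSFF f X Y m) :=
  (IsImag.cov (hf.smoothAt_lieMap hY m) fun m' => hf.isImag_lieMap m' (Y m')).sub
    (hf.isImag_lieMap m _)

/-- Differentiate g(JX, Y) = 0 along Z: the tangential part of G measures the asymmetry of the cubic
form in its last two arguments. -/
lemma IsLagrangianImmersion.metric0_trivG_eq (hf : IsLagrangianImmersion f)
    (hX : IsSmoothField X) (hY : IsSmoothField Y) (m : M) :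
    metric0 (trivG (lieMap f m (Z m)) (lieMap f m (X m))) (lieMap f m (Y m))
      = cubicForm f Z X Y m - cubicForm f Z Y X m := by
  have h := vderiv_metric0 (f := f) (X := Z)
    (vderiv_linear trivJ (hf.smoothAt_lieMap hX m) 0).1 (hf.smoothAt_lieMap hY m)
  have e : (fun m => metric0 (trivJ (lieMap f m (X m))) (lieMap f m (Y m))) = fun _ => 0 :=
    funext fun m => hf.metric0_trivJ_lieMap m _ _
  rw [e, vderiv_const, cov_trivJ (hf.smoothAt_lieMap hX m), metric0_add_left, metric0_trivJ_left,
    hf.metric0_cov_trivJ, metric0_comm (trivJ _), hf.metric0_cov_trivJ] at h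
  simp only [cubicForm]
  linarith

section

variable [T2Space M]

lemma IsLagrangianImmersion.isSmoothField_indConn (hf : IsLagrangianImmersion f)
    (hX : IsSmoothField X) (hY : IsSmoothField Y) : IsSmoothField (indConn f X Y) := by
  rw [hf.indConn_eq]
  exact hf.isSmoothField_tanPart (hf.smoothAt_cov hX (hf.smoothAt_lieMap hY))

lemma IsLagrangianImmersion.smoothAt_lieSFF (hf : IsLagrangianImmersion f)
    (hX : IsSmoothField X) (hY : IsSmoothField Y) (m : M) : SmoothAt (lieSFF f X Y) m :=
  (hf.smoothAt_cov hX (hf.smoothAt_lieMap hY) m).sub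
    (hf.smoothAt_lieMap (hf.isSmoothField_indConn hX hY) m)

lemma IsLagrangianImmersion.metric0_lieSFF_lieMap (hf : IsLagrangianImmersion f) (m : M)
    (w : TangentSpace (𝓡 3) m) : metric0 (lieSFF f X Y m) (lieMap f m w) = 0 := by
  rw [lieSFF, hf.indConn_eq]
  exact hf.metric0_sub_tanPart m _ w

/-- The normal vector h(X,Y) is Ju with u tangent, and J is an isometry, so the pairing reduces to
that of u with a normal vector. -/
lemma IsLagrangianImmersion.metric0_trivJ_lieSFF (hf : IsLagrangianImmersion f)
    (hY : IsSmoothField Y) (m : M) {Z W} :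
    metric0 (lieSFF f X Y m) (trivJ (lieSFF f Z W m)) = 0 := by
  obtain ⟨u, hu⟩ := hf.exists_trivJ_eq (hf.isImag_lieSFF (X := X) hY m)
    fun w => hf.metric0_lieSFF_lieMap m w
  rw [hu, metric0_trivJ_trivJ, metric0_comm]
  exact hf.metric0_lieSFF_lieMap m u

/-- By absence of torsion the difference of the two sides is tangent; it is also normal, hence zero.
-/
lemma IsLagrangianImmersion.lieSFF_comm (hf : IsLagrangianImmersion f)
    (hX : IsSmoothField X) (hY : IsSmoothField Y) (m : M) : lieSFF f X Y m = lieSFF f Y X m := by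
  obtain ⟨b, hb, -⟩ := hf.exists_bracket hX hY m
  have h : lieSFF f X Y m - lieSFF f Y X m
      = lieMap f m (b - indConn f X Y m + indConn f Y X m) := by
    rw [map_add, map_sub, ← hb, lieSFF, lieSFF]
    abel
  refine sub_eq_zero.1 (metric0_self_pos ?_)
  nth_rw 2 [h]
  rw [← trivMetric_apply, map_sub, LinearMap.sub_apply, trivMetric_apply, trivMetric_apply,
    hf.metric0_lieSFF_lieMap, hf.metric0_lieSFF_lieMap, sub_zero]

lemma IsLagrangianImmersion.cubicForm_comm (hf : IsLagrangianImmersion f)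
    (hX : IsSmoothField X) (hY : IsSmoothField Y) (m : M) :
    cubicForm f X Y Z m = cubicForm f Y X Z m := by
  rw [cubicForm, cubicForm, hf.lieSFF_comm hX hY]

/-- On a Lagrangian submanifold, `G(X, Y)` is normal. -/
lemma IsLagrangianImmersion.metric0_trivG_field (hf : IsLagrangianImmersion f)
    (hX : IsSmoothField X) (hY : IsSmoothField Y) (hZ : IsSmoothField Z) (m : M) :
    metric0 (trivG (lieMap f m (X m)) (lieMap f m (Y m))) (lieMap f m (Z m)) = 0 := by
  have h1 := hf.metric0_trivG_eq (Z := X) hY hZ m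
  have h2 := hf.metric0_trivG_eq (Z := Y) hZ hX m
  have h3 := hf.metric0_trivG_eq (Z := Z) hX hY m
  rw [hf.cubicForm_comm hX hZ, hf.cubicForm_comm hY hX] at *
  rw [hf.cubicForm_comm hZ hY] at *
  -- The form g(G(a,b), c) is invariant under cyclic permutations, while the three asymmetries `h1`,
  -- `h2`, `h3` sum to zero by symmetry of h. Hence three times the value is zero.
  have s1 : ∀ a b c : HH, metric0 (trivG a b) c = metric0 (trivG b c) a := by
    intro a b c
    rw [metric0_comm (trivG b c), ← neg_neg (metric0 a _), ← metric0_trivG_right, trivG_swap a b]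
    simp only [← trivMetric_apply, map_neg, LinearMap.neg_apply, neg_neg]
  have h4 := s1 (lieMap f m (X m)) (lieMap f m (Y m)) (lieMap f m (Z m))
  have h5 := s1 (lieMap f m (Y m)) (lieMap f m (Z m)) (lieMap f m (X m))
  linarith

lemma IsLagrangianImmersion.metric0_trivG (hf : IsLagrangianImmersion f) (m : M)
    (u v w : TangentSpace (𝓡 3) m) :
    metric0 (trivG (lieMap f m u) (lieMap f m v)) (lieMap f m w) = 0 := by
  obtain ⟨X, hX, rfl⟩ := exists_isSmoothField m u
  obtain ⟨Y, hY, rfl⟩ := exists_isSmoothField m v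
  obtain ⟨Z, hZ, rfl⟩ := exists_isSmoothField m w
  exact hf.metric0_trivG_field hX hY hZ m

/-- Since G(X,Y) is normal, the asymmetry vanishes; with `cubicForm_comm` the cubic form is totally
symmetric. -/
lemma IsLagrangianImmersion.cubicForm_swap (hf : IsLagrangianImmersion f)
    (hY : IsSmoothField Y) (hZ : IsSmoothField Z) (m : M) :
    cubicForm f X Y Z m = cubicForm f X Z Y m := by
  have h := hf.metric0_trivG_eq (Z := X) hY hZ m
  rw [hf.metric0_trivG] at h
  linarith

end

end

/-! ### The covariant derivative of h: Codazzi equation and symmetry defects. -/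

section

variable {M : Type*} [TopologicalSpace M] [ChartedSpace (EuclideanSpace ℝ (Fin 3)) M]

/-- The quadrilinear form `g((∇h)(X, Y, Z), J W)`. -/
def quarticForm (f : M → S3 × S3) (X Y Z W : ∀ m : M, TangentSpace (𝓡 3) m) (m : M) : ℝ :=
  nkMetric (emb f m) (nablaH f X Y Z m) (nkJ (emb f m) (dmap f m (W m)))

/-- `g(h(Y, Z), G(W, V))`. -/
def sffG (f : M → S3 × S3) (Y Z W V : ∀ m : M, TangentSpace (𝓡 3) m) (m : M) : ℝ :=
  metric0 (lieSFF f Y Z m) (trivG (lieMap f m (W m)) (lieMap f m (V m)))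

lemma sffG_swap (f : M → S3 × S3) (Y Z W V : ∀ m : M, TangentSpace (𝓡 3) m) (m : M) :
    sffG f Y Z V W m = - sffG f Y Z W V m := by
  rw [sffG, trivG_swap, ← trivMetric_apply, map_neg]
  rfl

/-- The tangential curvature term in the Codazzi equation. -/
lemma IsLagrangianImmersion.metric0_trivCurv {f : M → S3 × S3}
    (hf : IsLagrangianImmersion f) (m : M)
    (x y z w : TangentSpace (𝓡 3) m) :
    metric0 (trivCurv (lieMap f m x) (lieMap f m y) (lieMap f m z)) (trivJ (lieMap f m w)) =
      1 / 3 * (metric0 (trivP (lieMap f m y)) (lieMap f m z)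
          * metric0 (trivP (trivJ (lieMap f m x))) (lieMap f m w)
        - metric0 (trivP (lieMap f m x)) (lieMap f m z)
          * metric0 (trivP (trivJ (lieMap f m y))) (lieMap f m w)
        - metric0 (trivP (trivJ (lieMap f m y))) (lieMap f m z)
          * metric0 (trivP (lieMap f m x)) (lieMap f m w)
        + metric0 (trivP (trivJ (lieMap f m x))) (lieMap f m z)
          * metric0 (trivP (lieMap f m y)) (lieMap f m w)) := by
  have hK : ∀ a, scaledJ a = Real.sqrt 3 • trivJ a := by
    intro a
    rw [trivJ_apply, smul_smul, mul_one_div_cancel (by positivity), one_smul]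
  have h3 : Real.sqrt 3 * Real.sqrt 3 = 3 := Real.mul_self_sqrt (by norm_num)
  rw [trivCurv_eq (hf.isImag_lieMap m x) (hf.isImag_lieMap m y) (hf.isImag_lieMap m z)]
  simp only [hK]
  set a := lieMap f m x with ha
  set b := lieMap f m y with hb
  set c := lieMap f m z with hc
  set d := lieMap f m w with hd
  -- The Lagrangian condition kills the constant-curvature and J-terms of the curvature; only the
  -- terms with P are left.
  have e1 : metric0 a (trivJ d) = 0 := hf.metric0_lieMap_trivJ m x w
  have e2 : metric0 b (trivJ d) = 0 := hf.metric0_lieMap_trivJ m y w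
  have e3 : metric0 (trivJ a) c = 0 := hf.metric0_trivJ_lieMap m x z
  have e4 : metric0 (trivJ b) c = 0 := hf.metric0_trivJ_lieMap m y z
  have e5 : metric0 (trivJ a) b = 0 := hf.metric0_trivJ_lieMap m x y
  have e6 : ∀ a, metric0 (trivP a) (trivJ d) = metric0 (trivP (trivJ a)) d := by
    intro a
    rw [trivP_trivJ, ← trivMetric_apply (-_), map_neg, LinearMap.neg_apply, trivMetric_apply,
      metric0_trivJ_left, neg_neg]
  have e7 : ∀ a c, metric0 (trivJ (trivP a)) c = - metric0 (trivP (trivJ a)) c := by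
    intro a c
    rw [trivP_trivJ, ← trivMetric_apply (-_), map_neg, LinearMap.neg_apply, neg_neg,
      trivMetric_apply]
  simp only [← trivMetric_apply, map_sub, map_add, map_smul, LinearMap.sub_apply,
    LinearMap.add_apply, LinearMap.smul_apply, smul_eq_mul] at e1 e2 e3 e4 e5 e6 e7 ⊢
  simp only [trivMetric_apply, metric0_trivJ_trivJ] at e1 e2 e3 e4 e5 e6 e7 ⊢
  rw [e1, e2, e3, e4, e5, e6, e6, e7, e7]
  linear_combination 1 / 9 * (-metric0 (trivP (trivJ b)) c * metric0 (trivP a) d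
    + metric0 (trivP (trivJ a)) c * metric0 (trivP b) d) * h3

variable [IsManifold (𝓡 3) ∞ M] {f : M → S3 × S3}
  {X Y Z W V : ∀ m : M, TangentSpace (𝓡 3) m}

/-- Pairing with the normal vector JW makes the normal projection in the normal connection
superfluous. -/
lemma IsLagrangianImmersion.quarticForm_eq (hf : IsLagrangianImmersion f)
    (hZ : IsSmoothField Z) (m : M) : quarticForm f X Y Z W m =
      metric0 (cov f X (lieSFF f Y Z) m) (trivJ (lieMap f m (W m)))
        - cubicForm f (indConn f X Y) Z W m - cubicForm f Y (indConn f X Z) W m := by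
  have hx := emb_mem f m
  have h : norConn f X (secondFF f Y Z) m = leftMul (emb f m) (cov f X (lieSFF f Y Z) m
      - lieMap f m (tanPart f m (leftMul (emb f m) (cov f X (lieSFF f Y Z) m)))) := by
    rw [hf.secondFF_eq, norConn, hf.pullConn_leftMul X (hf.isImag_lieSFF hZ m), norPart_leftMul]
  rw [quarticForm, nablaH, h, hf.secondFF_eq, hf.secondFF_eq, ← leftMul_lieMap f m (W m),
    nkJ_leftMul_eq hx, ← leftMul_sub, ← leftMul_sub, nkMetric_leftMul hx]
  simp only [cubicForm, ← trivMetric_apply, map_sub, LinearMap.sub_apply]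
  rw [trivMetric_apply (lieMap f m _), hf.metric0_lieMap_trivJ, sub_zero]

variable [T2Space M]

/-- `∇h` in terms of the covariant derivative of the cubic form. -/
lemma IsLagrangianImmersion.quarticForm_eq_vderiv_cubicForm (hf : IsLagrangianImmersion f)
    (hY : IsSmoothField Y) (hZ : IsSmoothField Z) (hW : IsSmoothField W) (m : M) :
    quarticForm f X Y Z W m =
      vderiv (cubicForm f Y Z W) m (X m) - cubicForm f (indConn f X Y) Z W m
        - cubicForm f Y (indConn f X Z) W m - cubicForm f Y Z (indConn f X W) m
        - metric0 (lieSFF f Y Z m) (trivG (lieMap f m (X m)) (lieMap f m (W m))) := by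
  have hJ := (vderiv_linear trivJ (hf.smoothAt_lieMap hW m) 0).1
  have h : vderiv (cubicForm f Y Z W) m (X m) = _ :=
    vderiv_metric0 (f := f) (X := X) (hf.smoothAt_lieSFF hY hZ m) hJ
  -- The derivative of JW is J∇_X W + J h(X,W) + G(X,W), and the middle term is orthogonal to
  -- h(Y,Z).
  rw [cov_trivJ (hf.smoothAt_lieMap hW m), cov_eq_add, map_add, metric0_add_right,
    metric0_add_right, hf.metric0_trivJ_lieSFF hZ] at h
  rw [hf.quarticForm_eq hZ, h]
  simp only [cubicForm]
  ring

lemma IsLagrangianImmersion.sffG_comm (hf : IsLagrangianImmersion f) (hY : IsSmoothField Y)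
    (hZ : IsSmoothField Z) (m : M) : sffG f Y Z W V m = sffG f Z Y W V m := by
  rw [sffG, hf.lieSFF_comm hY hZ, sffG]

/-- The three last arguments of `g((∇h)(X, Y, Z), J W)`. -/
lemma IsLagrangianImmersion.quarticForm_swap_right (hf : IsLagrangianImmersion f)
    (hX : IsSmoothField X) (hY : IsSmoothField Y) (hZ : IsSmoothField Z) (hW : IsSmoothField W)
    (m : M) : quarticForm f X Y Z W m + sffG f Y Z X W m
      = quarticForm f X Y W Z m + sffG f Y W X Z m := by
  rw [hf.quarticForm_eq_vderiv_cubicForm hY hZ hW, hf.quarticForm_eq_vderiv_cubicForm hY hW hZ,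
    show cubicForm f Y Z W = cubicForm f Y W Z from funext fun m => hf.cubicForm_swap hZ hW m,
    hf.cubicForm_swap hZ hW, hf.cubicForm_swap (hf.isSmoothField_indConn hX hZ) hW,
    hf.cubicForm_swap hZ (hf.isSmoothField_indConn hX hW), sffG, sffG]
  ring

lemma IsLagrangianImmersion.quarticForm_swap_middle (hf : IsLagrangianImmersion f)
    (hX : IsSmoothField X) (hY : IsSmoothField Y) (hZ : IsSmoothField Z) (hW : IsSmoothField W)
    (m : M) : quarticForm f X Y Z W m = quarticForm f X Z Y W m := by
  rw [hf.quarticForm_eq_vderiv_cubicForm hY hZ hW, hf.quarticForm_eq_vderiv_cubicForm hZ hY hW,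
    show cubicForm f Y Z W = cubicForm f Z Y W from funext fun m => hf.cubicForm_comm hY hZ m,
    hf.cubicForm_comm (hf.isSmoothField_indConn hX hY) hZ,
    hf.cubicForm_comm hY (hf.isSmoothField_indConn hX hZ),
    hf.cubicForm_comm hY hZ, hf.lieSFF_comm hY hZ]
  ring

/-- The Codazzi equation. -/
lemma IsLagrangianImmersion.codazzi (hf : IsLagrangianImmersion f)
    (hX : IsSmoothField X) (hY : IsSmoothField Y) (hZ : IsSmoothField Z) (m : M) :
    quarticForm f X Y Z W m - quarticForm f Y X Z W m
      = metric0 (trivCurv (lieMap f m (X m)) (lieMap f m (Y m)) (lieMap f m (Z m)))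
          (trivJ (lieMap f m (W m))) := by
  obtain ⟨b, hb, hR⟩ := hf.exists_bracket hX hY m
  have hR := hR (lieField f Z) (hf.smoothAt_lieMap hZ)
  -- Write h(Y,Z) as the ambient derivative minus the induced one. The commutator of ambient
  -- derivatives then gives curvature plus a derivative along the bracket.
  have expand : ∀ {X Y : ∀ m : M, TangentSpace (𝓡 3) m}, IsSmoothField X → IsSmoothField Y →
      metric0 (cov f X (lieSFF f Y Z) m) (trivJ (lieMap f m (W m)))
        = metric0 (cov f X (cov f Y (lieField f Z)) m) (trivJ (lieMap f m (W m)))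
          - cubicForm f X (indConn f Y Z) W m := by
    intro X Y hX hY
    have h : cov f X (lieSFF f Y Z) m = _ := cov_sub (f := f) (X := X)
      (hf.smoothAt_cov hY (hf.smoothAt_lieMap hZ) m)
      (hf.smoothAt_lieMap (hf.isSmoothField_indConn hY hZ) m)
    rw [h, ← trivMetric_apply, map_sub, LinearMap.sub_apply, trivMetric_apply, trivMetric_apply,
      hf.metric0_cov_trivJ]
    rfl
  -- The induced connection is torsion-free, so the bracket term cancels the remaining cubic terms.
  have hb' : b = indConn f X Y m - indConn f Y X m := by
    apply hf.injective_lieMap m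
    rw [map_sub, ← hb, cov_eq_add, cov_eq_add, hf.lieSFF_comm hX hY]
    abel
  have htors : metric0 (vderiv (lieField f Z) m b + coeff (lieMap f m b) (lieMap f m (Z m)))
      (trivJ (lieMap f m (W m)))
      = cubicForm f (indConn f X Y) Z W m - cubicForm f (indConn f Y X) Z W m := by
    rw [cubicForm, cubicForm, ← hf.metric0_cov_trivJ, ← hf.metric0_cov_trivJ, hb',
      vderiv_sub_vec, map_sub, cov, cov]
    simp only [← trivMetric_apply, ← trivCoeff_apply, map_sub, map_add, LinearMap.sub_apply,
      LinearMap.add_apply]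
    ring
  have hR2 := congrArg (fun a => metric0 a (trivJ (lieMap f m (W m)))) hR
  simp only [metric0_add_left _ _ (trivJ (lieMap f m (W m)))] at hR2 htors
  rw [hf.quarticForm_eq hZ, hf.quarticForm_eq hZ, expand hX hY, expand hY hX]
  simp only [← trivMetric_apply, map_sub, LinearMap.sub_apply] at hR2 htors ⊢
  linarith

/-- The cyclic identity for `g(h(W, Y), G(Z, V))`. -/
lemma IsLagrangianImmersion.sffG_cyclic (hf : IsLagrangianImmersion f)
    (hY : IsSmoothField Y) (hZ : IsSmoothField Z) (hV : IsSmoothField V) (m : M) :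
    sffG f W Y Z V m + sffG f W Z V Y m + sffG f W V Y Z m = 0 := by
  have hYs := hf.smoothAt_lieMap hY m
  have hZs := hf.smoothAt_lieMap hZ m
  have hG := vderiv_bilinear trivG hYs hZs (W m)
  have h := vderiv_metric0 (f := f) (X := W) hG.1 (hf.smoothAt_lieMap hV m)
  have e : (fun m => metric0 (trivG (lieMap f m (Y m)) (lieMap f m (Z m))) (lieMap f m (V m)))
      = fun _ => 0 := funext fun m => hf.metric0_trivG m _ _ _
  -- The relation g(G(Y,Z), V) = 0 is differentiated along W. By `coeff_scaledG`, (∇̃_W G)(Y,Z) is a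
  -- combination of JY, JZ and g(JY,Z) W, so it does not contribute against the tangent vector V.
  have hcov : metric0 (cov f W (fun m => trivG (lieMap f m (Y m)) (lieMap f m (Z m))) m)
        (lieMap f m (V m))
      = metric0 (trivG (cov f W (lieField f Y) m) (lieMap f m (Z m))) (lieMap f m (V m))
        + metric0 (trivG (lieMap f m (Y m)) (cov f W (lieField f Z) m)) (lieMap f m (V m)) := by
    have k := congrArg (fun a => metric0 a (lieMap f m (V m)))
      (coeff_scaledG (hf.isImag_lieMap m (W m)) (hf.isImag_lieMap m (Y m))
        (hf.isImag_lieMap m (Z m)))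
    have hK : ∀ u v, metric0 (scaledJ (lieMap f m u)) (lieMap f m v) = 0 := by
      intro u v
      have h := hf.metric0_trivJ_lieMap m u v
      rw [trivJ_apply, ← trivMetric_apply, map_smul, LinearMap.smul_apply, smul_eq_mul,
        mul_eq_zero] at h
      exact h.resolve_left (by positivity)
    have h := hG.2
    simp only [cov, h]
    simp only [trivG_apply, coeff_smul_right, ← trivMetric_apply, ← trivCoeff_apply, map_add,
      map_sub, map_smul, LinearMap.sub_apply, LinearMap.add_apply, LinearMap.smul_apply,
      smul_eq_mul] at k hK ⊢
    simp only [hK] at k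
    linear_combination (1 / Real.sqrt 3) * k
  rw [e, vderiv_const, hcov, cov_eq_add, cov_eq_add, cov_eq_add] at h
  have g0 := fun u v w => hf.metric0_trivG m u v w
  have g1 := metric0_trivG_right (lieMap f m (Z m)) (lieSFF f W Y m) (lieMap f m (V m))
  have g2 := metric0_trivG_right (lieMap f m (Y m)) (lieSFF f W Z m) (lieMap f m (V m))
  have g3 := metric0_comm (trivG (lieMap f m (Y m)) (lieMap f m (Z m))) (lieSFF f W V m)
  rw [trivG_swap (lieSFF f W Y m) (lieMap f m (Z m))] at g1
  rw [trivG_swap (lieMap f m (V m)) (lieMap f m (Y m))] at g2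
  simp only [sffG]
  simp only [← trivMetric_apply, map_add, map_neg, LinearMap.add_apply, LinearMap.neg_apply]
    at g0 g1 g2 g3 h ⊢
  -- Tangential parts of the derivatives drop out because G of tangent vectors is normal; the second
  -- fundamental form remains in each of the three slots.
  simp only [g0] at h
  linarith

end

/-! ### Polarization and the conclusion. -/

section

/-- A symmetric quadriadditive form which vanishes on the diagonal is zero. -/
lemma quadriadditive_eq_zero {A : Type*} [Add A] (F : A → A → A → A → ℝ)
    (h12 : ∀ a b c d, F a b c d = F b a c d) (h23 : ∀ a b c d, F a b c d = F a c b d)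
    (h34 : ∀ a b c d, F a b c d = F a b d c)
    (add4 : ∀ a b c d d', F a b c (d + d') = F a b c d + F a b c d')
    (hdiag : ∀ a, F a a a a = 0) (a b c d : A) : F a b c d = 0 := by
  have add3 : ∀ a b c c' d, F a b (c + c') d = F a b c d + F a b c' d := by
    intro a b c c' d
    rw [h34, add4, h34 a b d c, h34 a b d c']
  have add2 : ∀ a b b' c d, F a (b + b') c d = F a b c d + F a b' c d := by
    intro a b b' c d
    rw [h23, add3, h23 a c b, h23 a c b']
  have add1 : ∀ a a' b c d, F (a + a') b c d = F a b c d + F a' b c d := by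
    intro a a' b c d
    rw [h12, add2, h12 b a, h12 b a']
  have swap14 : ∀ a b, F a b b b = F b b b a := fun a b => by rw [h12, h23, h34]
  have cubic : ∀ x v, F x x x v = 0 := by
    intro x v
    have e1 := hdiag (x + v)
    have e2 := hdiag (x + (v + v))
    have e3 := hdiag (x + x + v)
    have i1 : F x x v x = F x x x v := h34 _ _ _ _
    have i2 : F x v x x = F x x x v := by rw [h23, i1]
    have i3 : F v x x x = F x x x v := by rw [h12, i2]
    have j1 : F x v x v = F x x v v := h23 _ _ _ _
    have j2 : F v x x v = F x x v v := by rw [h12, j1]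
    have j3 : F x v v x = F x x v v := by rw [h34, j1]
    have j4 : F v x v x = F x x v v := by rw [h12, j3]
    have j5 : F v v x x = F x x v v := by rw [h23, j4]
    have k1 : F v v x v = F v v v x := h34 _ _ _ _
    have k2 : F v x v v = F v v v x := by rw [h23, k1]
    have k3 : F x v v v = F v v v x := by rw [h12, k2]
    simp only [add1, add2, add3, add4, hdiag, i1, i2, i3, j1, j2, j3, j4, j5, k1, k2, k3]
      at e1 e2 e3
    linarith
  have quadratic : ∀ x y v, F x x y v = 0 := by
    intro x y v
    -- The two expansions are independent equations in F(x,x,y,v) and F(y,y,x,v).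
    have e1 := cubic (x + y) v
    have e2 := cubic (x + (y + y)) v
    have i1 : F x y x v = F x x y v := h23 _ _ _ _
    have i2 : F y x x v = F x x y v := by rw [h12, i1]
    have j1 : F y x y v = F y y x v := h23 _ _ _ _
    have j2 : F x y y v = F y y x v := by rw [h12, j1]
    simp only [add1, add2, add3, cubic, i1, i2, j1, j2] at e1 e2
    linarith
  have e := quadratic (a + b) c d
  simp only [add1, add2, quadratic, h12 b a] at e
  linarith

variable {M : Type*} [TopologicalSpace M] [ChartedSpace (EuclideanSpace ℝ (Fin 3)) M]

/-- The left-hand side of the polarized identity. -/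
def polarizedForm (f : M → S3 × S3) (r : ℝ) (m : M) (Y Z W V : ∀ m : M, TangentSpace (𝓡 3) m) :
    ℝ :=
  let y := lieMap f m (Y m)
  let z := lieMap f m (Z m)
  let w := lieMap f m (W m)
  let v := lieMap f m (V m)
  let a := fun x y => metric0 (trivP x) y
  let b := fun x y => metric0 (trivP (trivJ x)) y
  12 * quarticForm f Y Z W V m + 3 * (sffG f Y Z W V m + sffG f Z W Y V m + sffG f W Y Z V m)
    + 2 * ((a y z * b w v - b y z * a w v) + (a y w * b v z - b y w * a v z)
      + (a y v * b z w - b y v * a z w))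
    - 4 * r * (metric0 y z * metric0 w v + metric0 y w * metric0 v z + metric0 y v * metric0 z w)

/-- The cyclic sum of metric products contributes 3 g(v,v)², whence the common factor 12. -/
lemma polarizedForm_diag (f : M → S3 × S3) (r : ℝ) (m : M)
    (X : ∀ m : M, TangentSpace (𝓡 3) m) : polarizedForm f r m X X X X =
      12 * (quarticForm f X X X X m
        - r * (nkMetric (emb f m) (dmap f m (X m)) (dmap f m (X m))) ^ 2) := by
  have h : sffG f X X X X m = 0 := by linarith [sffG_swap f X X X X m]
  simp only [polarizedForm, h, ← leftMul_lieMap, nkMetric_leftMul (emb_mem f m)]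
  ring

lemma metric0_trivP_comm (x y : HH) : metric0 (trivP x) y = metric0 (trivP y) x := by
  rw [metric0_trivP_left, metric0_comm]

lemma metric0_trivP_trivJ_comm (x y : HH) :
    metric0 (trivP (trivJ x)) y = metric0 (trivP (trivJ y)) x := by
  rw [metric0_trivP_left, metric0_trivJ_left, metric0_comm, trivP_trivJ, ← trivMetric_apply,
    ← trivMetric_apply, map_neg, LinearMap.neg_apply]

variable [IsManifold (𝓡 3) ∞ M] {f : M → S3 × S3}

lemma IsLagrangianImmersion.polarizedIdentity_iff (hf : IsLagrangianImmersion f) (lam : M → ℝ) :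
    PolarizedIdentity f lam ↔ ∀ Y Z W V : (∀ m : M, TangentSpace (𝓡 3) m),
      IsSmoothField Y → IsSmoothField Z → IsSmoothField W → IsSmoothField V → ∀ m : M,
      polarizedForm f (lam m) m Y Z W V = 0 := by
  unfold PolarizedIdentity
  refine forall_congr' fun Y => forall_congr' fun Z => forall_congr' fun W => forall_congr' fun V =>
    forall_congr' fun hY => forall_congr' fun hZ => forall_congr' fun hW => forall_congr' fun hV =>
    forall_congr' fun m => ?_
  have hx := emb_mem f m
  simp only [polarizedForm, cyclicSum, quarticForm, sffG, hf.secondFF_eq, ← leftMul_lieMap,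
    nkJ_leftMul_eq hx, nkP_leftMul hx, nkMetric_leftMul hx,
    nkG_leftMul hx (hf.isImag_lieMap m _) (hf.isImag_lieMap m _)]

/-- Additivity is immediate in the last argument, which is never differentiated; in the other
arguments it follows from total symmetry. -/
lemma IsLagrangianImmersion.polarizedForm_add (hf : IsLagrangianImmersion f) (r : ℝ) (m : M)
    {Y Z W V V' : ∀ m : M, TangentSpace (𝓡 3) m} (hW : IsSmoothField W) :
    polarizedForm f r m Y Z W (V + V') = polarizedForm f r m Y Z W V
      + polarizedForm f r m Y Z W V' := by
  simp only [polarizedForm, hf.quarticForm_eq hW, cubicForm, sffG, Pi.add_apply,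
    ← trivMetric_apply, map_add, LinearMap.add_apply]
  ring

variable [T2Space M] {Y Z W V : ∀ m : M, TangentSpace (𝓡 3) m}

/-- The Codazzi defect carries 12 · 1/3 = 4. The P-terms, with factor 2, change by twice the same
expression with opposite sign. -/
lemma IsLagrangianImmersion.polarizedForm_swap_left (hf : IsLagrangianImmersion f) (r : ℝ) (m : M)
    (hY : IsSmoothField Y) (hZ : IsSmoothField Z) (hW : IsSmoothField W) :
    polarizedForm f r m Y Z W V = polarizedForm f r m Z Y W V := by
  have h := hf.codazzi (W := V) hY hZ hW m
  rw [hf.metric0_trivCurv] at h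
  simp only [polarizedForm]
  rw [hf.sffG_comm hZ hY, hf.sffG_comm hY hW, hf.sffG_comm hW hZ,
    metric0_comm (lieMap f m (Z m)) (lieMap f m (Y m)),
    metric0_trivP_comm (lieMap f m (Z m)) (lieMap f m (Y m)),
    metric0_trivP_trivJ_comm (lieMap f m (Z m)) (lieMap f m (Y m)),
    metric0_comm (lieMap f m (V m)) (lieMap f m (Z m)),
    metric0_trivP_comm (lieMap f m (V m)) (lieMap f m (Z m)),
    metric0_trivP_trivJ_comm (lieMap f m (V m)) (lieMap f m (Z m)),
    metric0_comm (lieMap f m (V m)) (lieMap f m (Y m)),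
    metric0_trivP_comm (lieMap f m (V m)) (lieMap f m (Y m)),
    metric0_trivP_trivJ_comm (lieMap f m (V m)) (lieMap f m (Y m))]
  linear_combination 12 * h

lemma IsLagrangianImmersion.polarizedForm_swap_middle (hf : IsLagrangianImmersion f) (r : ℝ)
    (m : M) (hY : IsSmoothField Y) (hZ : IsSmoothField Z) (hW : IsSmoothField W)
    (hV : IsSmoothField V) :
    polarizedForm f r m Y Z W V = polarizedForm f r m Y W Z V := by
  have h := hf.quarticForm_swap_middle hY hZ hW hV m
  simp only [polarizedForm]
  rw [hf.sffG_comm hW hZ, hf.sffG_comm hZ hY, hf.sffG_comm hY hW, h,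
    metric0_comm (lieMap f m (V m)) (lieMap f m (Z m)),
    metric0_trivP_comm (lieMap f m (V m)) (lieMap f m (Z m)),
    metric0_trivP_trivJ_comm (lieMap f m (V m)) (lieMap f m (Z m)),
    metric0_comm (lieMap f m (V m)) (lieMap f m (W m)),
    metric0_trivP_comm (lieMap f m (V m)) (lieMap f m (W m)),
    metric0_trivP_trivJ_comm (lieMap f m (V m)) (lieMap f m (W m)),
    metric0_comm (lieMap f m (W m)) (lieMap f m (Z m)),
    metric0_trivP_comm (lieMap f m (W m)) (lieMap f m (Z m)),
    metric0_trivP_trivJ_comm (lieMap f m (W m)) (lieMap f m (Z m))]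
  ring

/-- Two cyclic relations reduce every defect to a multiple of g(h(Y,Z), G(W,V)): −12 from ∇h, and 3
· 4 from the cyclic sum of h-terms. -/
lemma IsLagrangianImmersion.polarizedForm_swap_right (hf : IsLagrangianImmersion f) (r : ℝ)
    (m : M) (hY : IsSmoothField Y) (hZ : IsSmoothField Z) (hW : IsSmoothField W)
    (hV : IsSmoothField V) :
    polarizedForm f r m Y Z W V = polarizedForm f r m Y Z V W := by
  have h := hf.quarticForm_swap_right hY hZ hW hV m
  have c1 := hf.sffG_cyclic (W := Z) hY hW hV m
  have c2 := hf.sffG_cyclic (W := Y) hZ hW hV m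
  have s1 := sffG_swap f Y Z W V m
  have s2 := sffG_swap f Y V Z W m
  have s3 := sffG_swap f Z V Y W m
  have s4 := sffG_swap f Y W Z V m
  have s5 := sffG_swap f Z W Y V m
  have t1 := hf.sffG_comm (W := W) (V := V) hZ hY m
  have t2 := hf.sffG_comm (W := Z) (V := V) hW hY m
  have t3 := hf.sffG_comm (W := Z) (V := W) hV hY m
  simp only [polarizedForm]
  rw [metric0_comm (lieMap f m (V m)) (lieMap f m (Z m)),
    metric0_trivP_comm (lieMap f m (V m)) (lieMap f m (Z m)),
    metric0_trivP_trivJ_comm (lieMap f m (V m)) (lieMap f m (Z m)),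
    metric0_comm (lieMap f m (V m)) (lieMap f m (W m)),
    metric0_trivP_comm (lieMap f m (V m)) (lieMap f m (W m)),
    metric0_trivP_trivJ_comm (lieMap f m (V m)) (lieMap f m (W m)),
    metric0_comm (lieMap f m (W m)) (lieMap f m (Z m)),
    metric0_trivP_comm (lieMap f m (W m)) (lieMap f m (Z m)),
    metric0_trivP_trivJ_comm (lieMap f m (W m)) (lieMap f m (Z m))]
  linarith

variable (M) in
/-- The smooth vector fields on `M`. -/
def smoothFields : AddSubsemigroup (∀ m : M, TangentSpace (𝓡 3) m) where
  carrier := {X | IsSmoothField X}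
  add_mem' hX hY := ContMDiff.add_section hX hY

/-- Polarization is carried out at a fixed point m, over the additive semigroup of smooth fields, so
λ enters only through the number λ(m) and needs no regularity. -/
lemma IsLagrangianImmersion.isJIsotropicWith_iff (hf : IsLagrangianImmersion f) (lam : M → ℝ) :
    IsJIsotropicWith f lam ↔ PolarizedIdentity f lam := by
  rw [hf.polarizedIdentity_iff]
  constructor
  · intro h Y Z W V hY hZ hW hV m
    refine quadriadditive_eq_zero (A := smoothFields M)
      (fun a b c d => polarizedForm f (lam m) m a b c d)
      (fun a b c d => hf.polarizedForm_swap_left _ m a.2 b.2 c.2)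
      (fun a b c d => hf.polarizedForm_swap_middle _ m a.2 b.2 c.2 d.2)
      (fun a b c d => hf.polarizedForm_swap_right _ m a.2 b.2 c.2 d.2)
      (fun a b c d d' => hf.polarizedForm_add _ m c.2) (fun a => ?_)
      ⟨Y, hY⟩ ⟨Z, hZ⟩ ⟨W, hW⟩ ⟨V, hV⟩
    have := h m _ a.1 a.2 rfl
    rw [polarizedForm_diag, quarticForm, this, sub_self, mul_zero]
  · rintro h m v X hX rfl
    have := h X X X X hX hX hX hX m
    rw [polarizedForm_diag, quarticForm] at this
    linarith

end

end NKS3S3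

end

theorem proposition4p1 {M : Type*} [TopologicalSpace M] [T2Space M]
    [ChartedSpace (EuclideanSpace ℝ (Fin 3)) M] [IsManifold (𝓡 3) ∞ M]
    (f : M → NKS3S3.S3 × NKS3S3.S3) (hf : NKS3S3.IsLagrangianImmersion f) :
    (NKS3S3.IsJIsotropic f ↔ ∃ lam : M → ℝ, NKS3S3.PolarizedIdentity f lam) ∧
      ∀ lam : M → ℝ, NKS3S3.IsJIsotropicWith f lam ↔ NKS3S3.PolarizedIdentity f lam :=
  ⟨exists_congr hf.isJIsotropicWith_iff, hf.isJIsotropicWith_iff⟩
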